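/- Theorem (No free amplification). Consider finitely many bosonic modes with annihilation operators $a_i$; for $\alpha\in\mathbb{C}^n$ let $|\alpha\rangle=|\alpha_1\rangle\cdots|\alpha_n\rangle$ be the $n$-mode coherent state, and call a state classical if it is $\int|\beta\rangle\langle\beta|\,dP(\beta)$ for a probability measure $P$. A passive linear unitary is a unitary $U$ that conserves the total photon number and mixes the annihilation operators linearly, $a_iU=\sum_jV_{ij}\,U a_j$ for a complex matrix $V$. An instrument is in $\mathcal{P}_1$ if it is of the form $\mathcal{A}_m(\rho)=\mathrm{tr}_{A'}[(1_{S'}\otimes E^m_{A'})\,U(\rho_S\otimes\sigma_A)U^\dagger]$, where $\sigma_A$ is a classical state of finitely many ancilla modes $A$, $U$ is a passive linear unitary from the modes $S,A$ to the modes $S',A'$, and $\{E^m\}_m$ is a (countable) POVM on the modes $A'$. For $r\ge 2$ an instrument is in $\mathcal{P}_r$ if it is a (countable) coarse-graining of $(\mathcal{B}_{l|m}\circ\mathcal{A}_m)_{m,l}$, where $(\mathcal{A}_m)_m\in\mathcal{P}_{r-1}$ and $(\mathcal{B}_{l|m})_l\in\mathcal{P}_1$ for each $m$. Let $\mathcal{P}_{\mathbb{N}}=\bigcup_{r\ge1}\mathcal{P}_r$.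 (1) Let $\mathcal{A}$ be an element of an instrument in $\mathcal{P}_{\mathbb{N}}$, with $n$ input and $n'$ output modes. Then $\mathcal{A}$ is described by a (possibly continuous) set of Kraus operators: there are a $\sigma$-finite measure space $(\Omega,\mu)$ and a weakly measurable family of bounded operators $(K_m)_{m\in\Omega}$ such that, for every trace class $\rho$, $\mathcal{A}(\rho)=\int_\Omega K_m\rho K_m^\dagger\,d\mu(m)$ (in the weak sense, the matrix elements being integrable), and such that for every $m\in\Omega$ there are $c_m:\mathbb{C}^n\to\mathbb{C}$, $\delta_m\in\mathbb{C}^{n'}$ and a matrix $M_m\in\mathbb{C}^{n'\times n}$ all of whose singular values are at most $1$ with $$K_m|\alpha\rangle=c_m(\alpha)\,|M_m\alpha+\delta_m\rangle\qquad\text{for all }\alpha\in\mathbb{C}^n.$$ (2) Hence noiseless amplification is not free: if $n\ge1$, $g\in\mathbb{C}$, $|g|>1$ and $W\subseteq\mathbb{C}^n$ is open and non-empty, then no element $\mathcal{A}$ of an instrument in $\mathcal{P}_{\mathbb{N}}$ with $n$ input and $n$ output modes satisfies, for all $\alpha\in W$, $\mathcal{A}(|\alpha\rangle\langle\alpha|)=p(\alpha)\,|g\alpha\rangle\langle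 g\alpha|$ with some $p(\alpha)>0$. -/

import Mathlib

open MeasureTheory
open scoped InnerProductSpace

noncomputable section

namespace LinearOptics

/-! ### Fock space -/

/-- The Hilbert space of a finite set `ι` of bosonic modes in the occupation number representation:
square-summable functions of the occupation numbers `k : ι → ℕ`. -/
abbrev Fock (ι : Type) : Type := lp (fun _ : ι → ℕ => ℂ) 2

/-- The number state with occupation numbers `k`. -/
def numberState {ι : Type} (k : ι → ℕ) : Fock ι :=
  letI := Classical.decEq (ι → ℕ)
  lp.single 2 k 1

/-- The (unbounded) total number operator `∑ i, aᵢ† aᵢ`, on coordinates. -/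
def numberOp {ι : Type} [Fintype ι] (f : (ι → ℕ) → ℂ) : (ι → ℕ) → ℂ :=
  fun k => (∑ i, (k i : ℂ)) * f k

/-- The (unbounded) annihilation operator `aᵢ`, on coordinates. -/
def annihilate {ι : Type} [DecidableEq ι] (i : ι) (f : (ι → ℕ) → ℂ) : (ι → ℕ) → ℂ :=
  fun k => (Real.sqrt (k i + 1) : ℂ) * f (k + Pi.single i 1)

/-- The coordinates `exp (-|α|²/2) ∏ i, αᵢ ^ kᵢ / √(kᵢ!)` of a coherent state. -/
def coherentCoeff {ι : Type} [Fintype ι] (α : ι → ℂ) (k : ι → ℕ) : ℂ :=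
  (Real.exp (-(∑ i, ‖α i‖ ^ 2) / 2) : ℂ) *
    ∏ i, α i ^ k i / (Real.sqrt (Nat.factorial (k i)) : ℂ)

theorem norm_coherentCoeff_sq {ι : Type} [Fintype ι] (α : ι → ℂ) (k : ι → ℕ) :
    ‖coherentCoeff α k‖ ^ 2 = Real.exp (-(∑ i, ‖α i‖ ^ 2)) *
      ∏ i, (‖α i‖ ^ 2) ^ k i / (Nat.factorial (k i) : ℝ) := by
  rw [coherentCoeff, norm_mul, mul_pow, norm_prod, ← Finset.prod_pow]
  congr 1
  · rw [Complex.norm_real, Real.norm_eq_abs, abs_of_pos (Real.exp_pos _), ← Real.exp_nat_mul]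
    congr 1
    push_cast
    ring
  · refine Finset.prod_congr rfl fun i _ => ?_
    rw [norm_div, div_pow, norm_pow, Complex.norm_real, Real.norm_eq_abs, sq_abs,
      Real.sq_sqrt (Nat.cast_nonneg _), ← pow_mul, ← pow_mul, mul_comm]

theorem memℓp_coherentCoeff {ι : Type} [Fintype ι] (α : ι → ℂ) :
    Memℓp (coherentCoeff α) 2 := by
  classical
  refine memℓp_gen' (C := 1) fun s => ?_
  obtain ⟨N, hN⟩ : ∃ N : ℕ, ∀ k ∈ s, ∀ i, k i < N := by
    refine ⟨s.sup (fun k => Finset.univ.sup k) + 1, fun k hk i => Nat.lt_succ_of_le ?_⟩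
    exact (Finset.le_sup (f := k) (Finset.mem_univ i)).trans
      (Finset.le_sup (f := fun k : ι → ℕ => Finset.univ.sup k) hk)
  have hs : s ⊆ Fintype.piFinset fun _ : ι => Finset.range N := by
    intro k hk
    simpa [Fintype.mem_piFinset] using hN k hk
  have h2 : ∀ k, ‖coherentCoeff α k‖ ^ (2 : ENNReal).toReal = ‖coherentCoeff α k‖ ^ 2 := by
    intro k
    simp
  simp only [h2]
  refine (Finset.sum_le_sum_of_subset_of_nonneg hs fun _ _ _ => by positivity).trans ?_
  simp only [norm_coherentCoeff_sq]
  rw [← Finset.mul_sum,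
    ← Finset.prod_univ_sum (fun _ : ι => Finset.range N)
      (fun i j => (‖α i‖ ^ 2) ^ j / (Nat.factorial j : ℝ)), Real.exp_neg, Real.exp_sum]
  rw [inv_mul_le_iff₀ (by positivity), mul_one]
  refine Finset.prod_le_prod (fun i _ => by positivity) fun i _ => ?_
  exact Real.sum_le_exp_of_nonneg (by positivity) N

/-- The coherent state `|α⟩ = |α₁⟩ … |αₙ⟩`. -/
def coherent {ι : Type} [Fintype ι] (α : ι → ℂ) : Fock ι :=
  ⟨coherentCoeff α, memℓp_coherentCoeff α⟩

/-! ### Composite systems -/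

/-- Occupation numbers of a composite system are pairs of occupation numbers. -/
def splitModes (ι κ : Type) : (ι ⊕ κ → ℕ) ≃ (ι → ℕ) × (κ → ℕ) :=
  Equiv.sumArrowEquivProdArrow ι κ ℕ

theorem summable_sq {X : Type} (f : lp (fun _ : X => ℂ) 2) : Summable fun x => ‖f x‖ ^ 2 := by
  have h := (memℓp_gen_iff (p := 2) (by norm_num)).1 (lp.memℓp f)
  simpa using h

theorem norm_sq_eq_tsum {X : Type} (f : lp (fun _ : X => ℂ) 2) : ‖f‖ ^ 2 = ∑' x, ‖f x‖ ^ 2 := by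
  have h := lp.norm_rpow_eq_tsum (p := 2) (by norm_num) f
  simpa using h

theorem memℓp_two {X : Type} {f : X → ℂ} (h : Summable fun x => ‖f x‖ ^ 2) : Memℓp f 2 := by
  refine memℓp_gen ?_
  simpa using h

/-- The product vector `ψ ⊗ φ`. -/
def tensorVec {ι κ : Type} (ψ : Fock ι) (φ : Fock κ) : Fock (ι ⊕ κ) :=
  ⟨fun k => ψ (splitModes ι κ k).1 * φ (splitModes ι κ k).2, by
    refine memℓp_two ?_
    have h := (summable_sq ψ).mul_of_nonneg (summable_sq φ) (fun _ => by positivity)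
      (fun _ => by positivity)
    have h' := (splitModes ι κ).summable_iff.2 h
    simpa [Function.comp_def, mul_pow] using h'⟩

section Slices

variable {X Y Z : Type} (e : Z ≃ X × Y)

/-- For fixed `y`, the vector `x ↦ f (x, y)`. -/
def slice (f : lp (fun _ : Z => ℂ) 2) (y : Y) : lp (fun _ : X => ℂ) 2 :=
  ⟨fun x => f (e.symm (x, y)), by
    refine memℓp_two ?_
    have h := e.symm.summable_iff.2 (summable_sq f)
    exact h.comp_injective (i := fun x : X => (x, y)) fun a b hab => (Prod.mk.inj hab).1⟩

theorem hasSum_slice (f : lp (fun _ : Z => ℂ) 2) :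
    HasSum (fun y => ‖slice e f y‖ ^ 2) (‖f‖ ^ 2) := by
  have h : Summable fun p : Y × X => ‖f (e.symm (p.2, p.1))‖ ^ 2 :=
    ((Equiv.prodComm Y X).trans e.symm).summable_iff.2 (summable_sq f)
  have h1 : (∑' p : Y × X, ‖f (e.symm (p.2, p.1))‖ ^ 2) = ‖f‖ ^ 2 := by
    rw [norm_sq_eq_tsum]
    exact ((Equiv.prodComm Y X).trans e.symm).tsum_eq (fun z => ‖f z‖ ^ 2)
  have h2 := h.hasSum.prod_fiberwise (g := fun y => ‖slice e f y‖ ^ 2) fun y => by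
    rw [norm_sq_eq_tsum]
    exact (summable_sq (slice e f y)).hasSum
  rwa [h1] at h2

theorem summable_sliceMap (S : lp (fun _ : X => ℂ) 2 →L[ℂ] lp (fun _ : X => ℂ) 2)
    (f : lp (fun _ : Z => ℂ) 2) :
    Summable (fun z => ‖S (slice e f (e z).2) (e z).1‖ ^ 2) ∧
      (∑' z, ‖S (slice e f (e z).2) (e z).1‖ ^ 2) ≤ (‖S‖ * ‖f‖) ^ 2 := by
  have hle : ∀ y, ‖S (slice e f y)‖ ^ 2 ≤ ‖S‖ ^ 2 * ‖slice e f y‖ ^ 2 := fun y => by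
    rw [← mul_pow]
    exact pow_le_pow_left₀ (norm_nonneg _) (S.le_opNorm _) 2
  have hs := (hasSum_slice e f).mul_left (‖S‖ ^ 2)
  have hy : Summable fun y => ‖S (slice e f y)‖ ^ 2 :=
    Summable.of_nonneg_of_le (fun _ => by positivity) hle hs.summable
  have hp : Summable fun p : Y × X => ‖S (slice e f p.1) p.2‖ ^ 2 := by
    rw [summable_prod_of_nonneg fun _ => by positivity]
    refine ⟨fun y => summable_sq (S (slice e f y)), ?_⟩
    refine hy.congr fun y => ?_
    exact norm_sq_eq_tsum (S (slice e f y))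
  have ht : (∑' p : Y × X, ‖S (slice e f p.1) p.2‖ ^ 2) = ∑' y, ‖S (slice e f y)‖ ^ 2 := by
    rw [hp.tsum_prod]
    exact tsum_congr fun y => (norm_sq_eq_tsum (S (slice e f y))).symm
  obtain ⟨F, hF⟩ : ∃ F : Y × X → ℝ, F = fun p => ‖S (slice e f p.1) p.2‖ ^ 2 := ⟨_, rfl⟩
  have hz : (fun z => ‖S (slice e f (e z).2) (e z).1‖ ^ 2)
      = fun z => F ((e.trans (Equiv.prodComm X Y)) z) := by
    subst hF
    rfl
  rw [← hF] at hp ht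
  rw [hz]
  refine ⟨(e.trans (Equiv.prodComm X Y)).summable_iff.2 hp, ?_⟩
  calc (∑' z, F ((e.trans (Equiv.prodComm X Y)) z))
      = ∑' p : Y × X, F p := (e.trans (Equiv.prodComm X Y)).tsum_eq F
    _ = ∑' y, ‖S (slice e f y)‖ ^ 2 := ht
    _ ≤ ∑' y, ‖S‖ ^ 2 * ‖slice e f y‖ ^ 2 := hy.tsum_le_tsum hle hs.summable
    _ = (‖S‖ * ‖f‖) ^ 2 := by rw [hs.tsum_eq, mul_pow]

/-- The operator that applies `S` to the `X` coordinate and the identity to the `Y` coordinate. -/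
def sliceMap (S : lp (fun _ : X => ℂ) 2 →L[ℂ] lp (fun _ : X => ℂ) 2) :
    lp (fun _ : Z => ℂ) 2 →L[ℂ] lp (fun _ : Z => ℂ) 2 :=
  LinearMap.mkContinuous
    { toFun := fun f => ⟨fun z => S (slice e f (e z).2) (e z).1,
        memℓp_two (summable_sliceMap e S f).1⟩
      map_add' := fun f g => by
        ext z
        have : slice e (f + g) (e z).2 = slice e f (e z).2 + slice e g (e z).2 := by
          ext x; rfl
        change S (slice e (f + g) (e z).2) (e z).1 = _
        rw [this, map_add]
        rfl
      map_smul' := fun c f => by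
        ext z
        have : slice e (c • f) (e z).2 = c • slice e f (e z).2 := by
          ext x; rfl
        change S (slice e (c • f) (e z).2) (e z).1 = _
        rw [this, map_smul]
        rfl }
    ‖S‖ fun f => by
      refine le_of_sq_le_sq ?_ (by positivity)
      rw [norm_sq_eq_tsum]
      exact (summable_sliceMap e S f).2

end Slices

/-- `S ⊗ 1`. -/
def onLeft {ι κ : Type} (S : Fock ι →L[ℂ] Fock ι) : Fock (ι ⊕ κ) →L[ℂ] Fock (ι ⊕ κ) :=
  sliceMap (splitModes ι κ) S

/-- `1 ⊗ T`. -/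
def onRight {ι κ : Type} (T : Fock κ →L[ℂ] Fock κ) : Fock (ι ⊕ κ) →L[ℂ] Fock (ι ⊕ κ) :=
  sliceMap ((splitModes ι κ).trans (Equiv.prodComm _ _)) T

/-- `S ⊗ T`. -/
def tensorOp {ι κ : Type} (S : Fock ι →L[ℂ] Fock ι) (T : Fock κ →L[ℂ] Fock κ) :
    Fock (ι ⊕ κ) →L[ℂ] Fock (ι ⊕ κ) :=
  onLeft S ∘L onRight T

theorem onLeft_tensorVec {ι κ : Type} (S : Fock ι →L[ℂ] Fock ι) (ψ : Fock ι) (φ : Fock κ) :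
    onLeft S (tensorVec ψ φ) = tensorVec (S ψ) φ := by
  ext k
  have : slice (splitModes ι κ) (tensorVec ψ φ) (splitModes ι κ k).2
      = φ (splitModes ι κ k).2 • ψ := by
    ext x
    exact mul_comm _ _
  change S (slice (splitModes ι κ) (tensorVec ψ φ) (splitModes ι κ k).2) (splitModes ι κ k).1 = _
  rw [this, map_smul]
  exact mul_comm _ _

theorem onRight_tensorVec {ι κ : Type} (T : Fock κ →L[ℂ] Fock κ) (ψ : Fock ι) (φ : Fock κ) :
    onRight T (tensorVec ψ φ) = tensorVec ψ (T φ) := by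
  ext k
  have : slice ((splitModes ι κ).trans (Equiv.prodComm _ _)) (tensorVec ψ φ) (splitModes ι κ k).1
      = ψ (splitModes ι κ k).1 • φ := by
    ext x
    rfl
  change T (slice ((splitModes ι κ).trans (Equiv.prodComm _ _)) (tensorVec ψ φ)
    (splitModes ι κ k).1) (splitModes ι κ k).2 = _
  rw [this, map_smul]
  rfl

theorem tensorOp_tensorVec {ι κ : Type} (S : Fock ι →L[ℂ] Fock ι) (T : Fock κ →L[ℂ] Fock κ)
    (ψ : Fock ι) (φ : Fock κ) : tensorOp S T (tensorVec ψ φ) = tensorVec (S ψ) (T φ) := by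
  rw [tensorOp, ContinuousLinearMap.comp_apply, onRight_tensorVec, onLeft_tensorVec]

/-! ### States and operations -/

/-- The trace class operators: the linear span of the positive operators of finite trace. -/
def TraceClass (ι : Type) : Submodule ℂ (Fock ι →L[ℂ] Fock ι) :=
  Submodule.span ℂ {T | T.IsPositive ∧
    Summable fun k : ι → ℕ => ⟪numberState k, T (numberState k)⟫_ℂ}

/-- The rank one operator `|ψ⟩⟨ψ|`. -/
def proj {ι : Type} (ψ : Fock ι) : Fock ι →L[ℂ] Fock ι := InnerProductSpace.rankOne ℂ ψ ψ

theorem inner_numberState {ι : Type} (k : ι → ℕ) (ψ : Fock ι) : ⟪numberState k, ψ⟫_ℂ = ψ k := by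
  classical
  have := lp.inner_single_left (𝕜 := ℂ) k (1 : ℂ) ψ
  rw [numberState]
  convert this using 1
  simp

theorem proj_mem_traceClass {ι : Type} (ψ : Fock ι) : proj ψ ∈ TraceClass ι := by
  refine Submodule.subset_span ⟨?_, ?_⟩
  · exact InnerProductSpace.isPositive_rankOne_self ψ
  · have h : ∀ k : ι → ℕ, ⟪numberState k, proj ψ (numberState k)⟫_ℂ = ((‖ψ k‖ ^ 2 : ℝ) : ℂ) := by
      intro k
      rw [proj, InnerProductSpace.rankOne_apply, inner_smul_right, inner_numberState,
        ← inner_conj_symm, inner_numberState, Complex.conj_mul']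
      push_cast
      rfl
    simp only [h]
    exact Complex.ofRealCLM.summable (summable_sq ψ)

/-- `|ψ⟩⟨ψ|` as a trace class operator. -/
def pure {ι : Type} (ψ : Fock ι) : TraceClass ι := ⟨proj ψ, proj_mem_traceClass ψ⟩

/-- Linear maps taking trace class operators on `n` modes to trace class operators on `n'` modes. -/
abbrev Op (n n' : ℕ) : Type := TraceClass (Fin n) →ₗ[ℂ] TraceClass (Fin n')

/-- `R` is the partial trace of `T` over the modes `κ`. -/
def IsPartialTrace {ι κ : Type} (T : Fock (ι ⊕ κ) →L[ℂ] Fock (ι ⊕ κ))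
    (R : Fock ι →L[ℂ] Fock ι) : Prop :=
  ∀ φ φ' : Fock ι, HasSum (fun k : κ → ℕ =>
    ⟪tensorVec φ (numberState k), T (tensorVec φ' (numberState k))⟫_ℂ) ⟪φ, R φ'⟫_ℂ

/-- `σ` is a classical state: `σ = ∫ |β⟩⟨β| dP(β)` for a probability measure `P`. -/
def IsClassical {ι : Type} [Fintype ι] (σ : Fock ι →L[ℂ] Fock ι) : Prop :=
  ∃ P : Measure (ι → ℂ), IsProbabilityMeasure P ∧
    ∀ φ φ' : Fock ι, ⟪φ, σ φ'⟫_ℂ = ∫ β, ⟪φ, proj (coherent β) φ'⟫_ℂ ∂P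

/-- A passive linear unitary: it conserves the total photon number (it intertwines the number
operators, domains included) and it mixes the annihilation operators linearly,
`aᵢ U = ∑ j, Vᵢⱼ U aⱼ`. Input and output modes may be labelled differently. -/
structure IsPassiveLinear {ι κ : Type} [Fintype ι] [DecidableEq ι] [Fintype κ] [DecidableEq κ]
    (U : Fock ι ≃ₗᵢ[ℂ] Fock κ) : Prop where
  number_conserving : ∀ ψ φ : Fock ι, (φ : (ι → ℕ) → ℂ) = numberOp ψ →
    (U φ : (κ → ℕ) → ℂ) = numberOp (U ψ)
  linear : ∃ V : Matrix κ ι ℂ, ∀ (ψ : Fock ι) (φ : ι → Fock ι),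
    (∀ j, (φ j : (ι → ℕ) → ℂ) = annihilate j ψ) →
    ∀ i, annihilate i (U ψ) = ((∑ j, V i j • U (φ j) : Fock κ) : (κ → ℕ) → ℂ)

/-- A POVM: positive operators that sum to the identity (weakly). -/
structure IsPOVM {κ J : Type} (E : J → Fock κ →L[ℂ] Fock κ) : Prop where
  positive : ∀ m, (E m).IsPositive
  sum_eq_one : ∀ φ φ' : Fock κ, HasSum (fun m => ⟪φ, E m φ'⟫_ℂ) ⟪φ, φ'⟫_ℂ

/-- One round: the input modes are joined by `a` ancilla modes in a classical state `σ`, a passive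
linear unitary takes these `n + a` modes to `n' + a'` modes, and the last `a'` modes are measured
with a POVM and discarded, so that
`A m ρ = tr_{A'} [(1 ⊗ E m) U (ρ ⊗ σ) U†]`. -/
def IsOneRound {n n' : ℕ} {J : Type} (A : J → Op n n') : Prop :=
  ∃ (a a' : ℕ) (σ : Fock (Fin a) →L[ℂ] Fock (Fin a))
    (U : Fock (Fin n ⊕ Fin a) ≃ₗᵢ[ℂ] Fock (Fin n' ⊕ Fin a'))
    (E : J → Fock (Fin a') →L[ℂ] Fock (Fin a')),
    IsClassical σ ∧ IsPassiveLinear U ∧ IsPOVM E ∧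
    ∀ (m : J) (ρ : TraceClass (Fin n)),
      IsPartialTrace
        (onRight (E m) ∘L (U : Fock (Fin n ⊕ Fin a) →L[ℂ] Fock (Fin n' ⊕ Fin a')) ∘L
          tensorOp (ρ : Fock (Fin n) →L[ℂ] Fock (Fin n)) σ ∘L
          (U.symm : Fock (Fin n' ⊕ Fin a') →L[ℂ] Fock (Fin n ⊕ Fin a)))
        (A m ρ : Fock (Fin n') →L[ℂ] Fock (Fin n'))

/-- `A'` is a coarse-graining of `A`: the outcomes of `A` are partitioned, and each element of `A'`
is the sum of the elements of `A` in one part. -/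
def IsCoarseGraining {n n' : ℕ} {J J' : Type} (A : J → Op n n') (A' : J' → Op n n') : Prop :=
  ∃ part : J → J', ∀ (l : J') (ρ : TraceClass (Fin n)) (φ φ' : Fock (Fin n')),
    HasSum (fun m : {m : J // part m = l} =>
        ⟪φ, (A m ρ : Fock (Fin n') →L[ℂ] Fock (Fin n')) φ'⟫_ℂ)
      ⟪φ, (A' l ρ : Fock (Fin n') →L[ℂ] Fock (Fin n')) φ'⟫_ℂ

/-- `InP r A`: the instrument `A = (A m)_m` is a free protocol with `r ≥ 1` measurement rounds.
In each further round, a one-round instrument `B m` that may depend on the outcome `m` so far is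
applied, and then some of the classical information may be forgotten. -/
inductive InP : ℕ → ∀ {n n' : ℕ} {J : Type}, (J → Op n n') → Prop
  | one {n n' : ℕ} {J : Type} [Countable J] {A : J → Op n n'} (h : IsOneRound A) : InP 1 A
  | link {r n n' n'' : ℕ} {J J' : Type} [Countable J'] {L : J → Type} [∀ m, Countable (L m)]
      {A : J → Op n n'} (B : ∀ m, L m → Op n' n'') {A' : J' → Op n n''}
      (hA : InP r A) (hB : ∀ m, IsOneRound (B m))
      (h : IsCoarseGraining (fun x : Σ m, L m => (B x.1 x.2).comp (A x.1)) A') :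
      InP (r + 1) A'

/-- The instruments of all finite-length free protocols. -/
def IsFree {n n' : ℕ} {J : Type} (A : J → Op n n') : Prop := ∃ r, InP r A

/-- `(K ω)` is a (possibly continuous) family of Kraus operators for `A`:
`A ρ = ∫ K ω ρ (K ω)† dμ(ω)`. -/
structure IsKrausFamily {n n' : ℕ} (A : Op n n') {Ω : Type} [MeasurableSpace Ω] (μ : Measure Ω)
    (K : Ω → Fock (Fin n) →L[ℂ] Fock (Fin n')) : Prop where
  measurable : ∀ (ψ : Fock (Fin n)) (φ : Fock (Fin n')), Measurable fun ω => ⟪φ, K ω ψ⟫_ℂ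
  integrable : ∀ (ρ : TraceClass (Fin n)) (φ φ' : Fock (Fin n')),
    Integrable (fun ω => ⟪φ, (K ω ∘L (ρ : Fock (Fin n) →L[ℂ] Fock (Fin n)) ∘L
      ContinuousLinearMap.adjoint (K ω)) φ'⟫_ℂ) μ
  apply_eq : ∀ (ρ : TraceClass (Fin n)) (φ φ' : Fock (Fin n')),
    ⟪φ, (A ρ : Fock (Fin n') →L[ℂ] Fock (Fin n')) φ'⟫_ℂ =
      ∫ ω, ⟪φ, (K ω ∘L (ρ : Fock (Fin n) →L[ℂ] Fock (Fin n)) ∘L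
        ContinuousLinearMap.adjoint (K ω)) φ'⟫_ℂ ∂μ

/-- All singular values of the matrix `M` are at most `1`. -/
def IsContraction {n n' : ℕ} (M : Matrix (Fin n') (Fin n) ℂ) : Prop :=
  ∀ i, (Matrix.toEuclideanLin M).singularValues i ≤ 1

end LinearOptics

end

noncomputable section

namespace LinearOptics

open scoped ComplexOrder

/-! Coherent states are the joint eigenvectors of the annihilation operators. A passive linear
unitary mixes these operators linearly, so it sends `|γ⟩` to a multiple of `|Vγ⟩`; since it
preserves overlaps with the vacuum, `V` is isometric (`IsPassiveLinear.exists_map_coherent`).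

In one round write `σ = ∫ |β⟩⟨β| dP(β)` and `E = Q²`. The operators `(1 ⊗ ⟨j|Q) U (1 ⊗ |β⟩)`,
indexed by number states `j` and amplitudes `β`, form a Kraus family for counting measure times `P`
(`isKrausFamily_of_isPartialTrace`). Each sends `|α⟩` to a multiple of `|V₁₁α + V₁₂β⟩`, and the
block `V₁₁` of an isometry is a contraction (`IsPassiveLinear.isCoherentMap_sandwich`). Maps of this
kind compose, and Kraus families survive composition (product measure) and countable sums (disjoint
union of measures), so induction on the rounds gives (1). The analysis is kept to positive `ρ` and
diagonal matrix elements, where integrands are nonnegative and Tonelli applies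
(`IsKrausFamily.of_lintegral`).

For (2), a pure output `|gα⟩` forces almost every `K` to map `|α⟩` into the line of `|gα⟩`,
simultaneously for a countable dense set of `α`. If such a `K` is nonzero at some point of `W`, then
by continuity `Mα + δ = gα` on an open set, hence `Mv = gv` for some `v ≠ 0`, which a contraction
forbids when `|g| > 1`. So almost every `K` vanishes on the coherent states of `W`, contradicting `p
> 0`. -/

/-! ### Number states -/

/-- The number states as a Hilbert basis. -/
def numberBasis (ι : Type) : HilbertBasis (ι → ℕ) ℂ (Fock ι) :=
  HilbertBasis.ofRepr (LinearIsometryEquiv.refl ℂ (Fock ι))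

theorem numberBasis_apply {ι : Type} (k : ι → ℕ) : numberBasis ι k = numberState k := by
  let _ := Classical.decEq (ι → ℕ)
  rw [← (numberBasis ι).repr_symm_single k]
  rfl

theorem hasSum_inner_numberState {ι : Type} (u v : Fock ι) :
    HasSum (fun k => ⟪u, numberState k⟫_ℂ * ⟪numberState k, v⟫_ℂ) ⟪u, v⟫_ℂ := by
  simpa only [numberBasis_apply] using (numberBasis ι).hasSum_inner_mul_inner u v

theorem hasSum_sq_inner_numberState {ι : Type} (u : Fock ι) :
    HasSum (fun k => ‖⟪numberState k, u⟫_ℂ‖ ^ 2) (‖u‖ ^ 2) := by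
  simp only [inner_numberState, norm_sq_eq_tsum u]
  exact (summable_sq u).hasSum

theorem tsum_enorm_sq_inner_numberState {ι : Type} (u : Fock ι) :
    ∑' k, ‖⟪numberState k, u⟫_ℂ‖ₑ ^ 2 = ‖u‖ₑ ^ 2 := by
  have h := hasSum_sq_inner_numberState u
  have h2 := ENNReal.ofReal_tsum_of_nonneg (fun k => by positivity) h.summable
  rw [h.tsum_eq] at h2
  simp only [← ofReal_norm, ← ENNReal.ofReal_pow (norm_nonneg _)]
  exact h2.symm

theorem eq_of_inner_numberState {ι : Type} {u v : Fock ι}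
    (h : ∀ k, ⟪numberState k, u⟫_ℂ = ⟪numberState k, v⟫_ℂ) : u = v := by
  ext k
  simpa only [inner_numberState] using h k

theorem clm_ext_numberState {ι : Type} {F : Type*} [NormedAddCommGroup F] [NormedSpace ℂ F]
    {S T : Fock ι →L[ℂ] F} (h : ∀ k, S (numberState k) = T (numberState k)) : S = T := by
  refine ContinuousLinearMap.ext_on ((Submodule.dense_iff_topologicalClosure_eq_top).2
    (numberBasis ι).dense_span) ?_
  rintro _ ⟨k, rfl⟩
  rw [numberBasis_apply]
  exact h k

theorem numberState_apply_self {ι : Type} (k : ι → ℕ) : numberState k k = 1 := by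
  simp [numberState]

theorem numberState_apply_of_ne {ι : Type} {k l : ι → ℕ} (h : l ≠ k) : numberState k l = 0 := by
  simp [numberState, h]

/-! ### Product vectors -/

theorem inner_tensorVec {ι κ : Type} (a c : Fock ι) (b d : Fock κ) :
    ⟪tensorVec a b, tensorVec c d⟫_ℂ = ⟪a, c⟫_ℂ * ⟪b, d⟫_ℂ := by
  obtain ⟨f, hf⟩ : ∃ f : (ι → ℕ) → ℂ, f = fun x => ⟪a x, c x⟫_ℂ := ⟨_, rfl⟩
  obtain ⟨g, hg⟩ : ∃ g : (κ → ℕ) → ℂ, g = fun x => ⟪b x, d x⟫_ℂ := ⟨_, rfl⟩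
  have h1 : HasSum f ⟪a, c⟫_ℂ := hf ▸ lp.hasSum_inner (𝕜 := ℂ) a c
  have h2 : HasSum g ⟪b, d⟫_ℂ := hg ▸ lp.hasSum_inner (𝕜 := ℂ) b d
  have h3 := h1.mul h2 (summable_mul_of_summable_norm h1.summable.norm h2.summable.norm)
  have h4 : HasSum (fun k => f (splitModes ι κ k).1 * g (splitModes ι κ k).2)
      (⟪a, c⟫_ℂ * ⟪b, d⟫_ℂ) := (Equiv.hasSum_iff (splitModes ι κ)).2 h3
  refine (lp.hasSum_inner (𝕜 := ℂ) (tensorVec a b) (tensorVec c d)).unique (h4.congr_fun ?_)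
  intro k
  change ⟪a (splitModes ι κ k).1 * b (splitModes ι κ k).2,
      c (splitModes ι κ k).1 * d (splitModes ι κ k).2⟫_ℂ = _
  rw [hf, hg]
  simp only [RCLike.inner_apply, map_mul]
  ring

theorem norm_tensorVec {ι κ : Type} (a : Fock ι) (b : Fock κ) :
    ‖tensorVec a b‖ = ‖a‖ * ‖b‖ := by
  have h := inner_tensorVec a a b b
  simp only [inner_self_eq_norm_sq_to_K] at h
  refine (sq_eq_sq₀ (norm_nonneg _) (by positivity)).1 ?_
  rw [mul_pow]
  exact_mod_cast h

/-- `φ ↦ φ ⊗ χ`. -/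
def tensorRight {κ : Type} (ι : Type) (χ : Fock κ) : Fock ι →L[ℂ] Fock (ι ⊕ κ) :=
  LinearMap.mkContinuous
    { toFun := fun φ => tensorVec φ χ
      map_add' := fun φ φ' => by ext k; exact add_mul _ _ _
      map_smul' := fun c φ => by ext k; exact mul_assoc _ _ _ } ‖χ‖ fun φ => by
    simp [norm_tensorVec, mul_comm]

theorem tensorRight_apply {ι κ : Type} (χ : Fock κ) (φ : Fock ι) :
    tensorRight ι χ φ = tensorVec φ χ := rfl

/-- `χ ↦ φ ⊗ χ`. -/
def tensorLeft {ι : Type} (κ : Type) (φ : Fock ι) : Fock κ →L[ℂ] Fock (ι ⊕ κ) :=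
  LinearMap.mkContinuous
    { toFun := fun χ => tensorVec φ χ
      map_add' := fun χ χ' => by ext k; exact mul_add _ _ _
      map_smul' := fun c χ => by ext k; exact mul_left_comm _ _ _ } ‖φ‖ fun χ => by
    simp [norm_tensorVec]

theorem numberState_eq_tensorVec {ι κ : Type} (k : ι ⊕ κ → ℕ) :
    numberState k =
      tensorVec (numberState (splitModes ι κ k).1) (numberState (splitModes ι κ k).2) := by
  ext l
  change _ = numberState (splitModes ι κ k).1 (splitModes ι κ l).1
    * numberState (splitModes ι κ k).2 (splitModes ι κ l).2
  by_cases h : l = k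
  · subst h
    simp [numberState_apply_self]
  · rw [numberState_apply_of_ne h]
    by_cases h1 : (splitModes ι κ l).1 = (splitModes ι κ k).1
    · rw [numberState_apply_of_ne (l := (splitModes ι κ l).2), mul_zero]
      intro h2
      exact h ((splitModes ι κ).injective (Prod.ext h1 h2))
    · rw [numberState_apply_of_ne h1, zero_mul]

/-- Both sides are bounded linear functionals of `v`, so it is enough to compare them on number
states, which are product vectors. -/
theorem inner_onRight_tensorVec {ι κ : Type} (E : Fock κ →L[ℂ] Fock κ) (φ : Fock ι) (χ : Fock κ)
    (v : Fock (ι ⊕ κ)) : ⟪tensorVec φ χ, onRight E v⟫_ℂ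
      = ⟪tensorVec φ (ContinuousLinearMap.adjoint E χ), v⟫_ℂ := by
  have h : innerSL ℂ (tensorVec φ χ) ∘L onRight E
      = innerSL ℂ (tensorVec φ (ContinuousLinearMap.adjoint E χ)) := by
    refine clm_ext_numberState fun k => ?_
    rw [numberState_eq_tensorVec]
    simp only [ContinuousLinearMap.comp_apply, innerSL_apply_apply, onRight_tensorVec,
      inner_tensorVec, ContinuousLinearMap.adjoint_inner_left]
  exact congrArg (fun f => f v) h

/-! ### Positive operators -/

/-- Applied to `ρ` and to the POVM elements, this turns expectation values into squared norms, which
Parseval expands into nonnegative terms. -/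
theorem exists_sqrt_of_isPositive {H : Type*} [NormedAddCommGroup H] [InnerProductSpace ℂ H]
    [CompleteSpace H] {T : H →L[ℂ] H} (hT : T.IsPositive) :
    ∃ S : H →L[ℂ] H, ContinuousLinearMap.adjoint S = S ∧ S ∘L S = T := by
  have h0 : 0 ≤ T := (ContinuousLinearMap.nonneg_iff_isPositive T).2 hT
  refine ⟨CFC.sqrt T, ?_, CFC.sqrt_mul_sqrt_self T h0⟩
  exact (IsSelfAdjoint.of_nonneg (CFC.sqrt_nonneg T)).star_eq

/-! ### Weak measurability -/

/-- The Parseval expansion has countably many terms because there are finitely many modes, so the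
inner product is a pointwise limit of measurable finite sums. -/
theorem measurable_inner_of_weak {Ω ι : Type} [Finite ι] [MeasurableSpace Ω]
    {u v : Ω → Fock ι} (hu : ∀ k, Measurable fun ω => ⟪numberState k, u ω⟫_ℂ)
    (hv : ∀ k, Measurable fun ω => ⟪numberState k, v ω⟫_ℂ) :
    Measurable fun ω => ⟪u ω, v ω⟫_ℂ := by
  refine measurable_of_tendsto_metrizable' Filter.atTop (f := fun (s : Finset (ι → ℕ)) ω =>
    ∑ k ∈ s, ⟪u ω, numberState k⟫_ℂ * ⟪numberState k, v ω⟫_ℂ) (fun s => ?_) ?_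
  · refine Finset.measurable_fun_sum s fun k _ => ?_
    refine Measurable.mul ?_ (hv k)
    simp only [← inner_conj_symm (u _)]
    exact (Complex.continuous_conj.measurable).comp (hu k)
  · rw [tendsto_pi_nhds]
    exact fun ω => hasSum_inner_numberState (u ω) (v ω)

/-! ### Coherent states -/

theorem hasSum_multi_exp {ι : Type} [Fintype ι] (z : ι → ℂ) :
    HasSum (fun k : ι → ℕ => ∏ i, z i ^ k i / (Nat.factorial (k i) : ℂ))
      (Complex.exp (∑ i, z i)) := by
  classical
  -- Cubes exhaust the multi-indices, and over a cube the sum factors into one-variable partial sums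
  -- of the exponential series.
  have hmono : Monotone fun N : ℕ => Fintype.piFinset fun _ : ι => Finset.range N := fun a b h =>
    Fintype.piFinset_subset _ _ fun _ => Finset.range_mono h
  have hexh : ∀ k : ι → ℕ, ∃ N : ℕ, k ∈ Fintype.piFinset fun _ : ι => Finset.range N := fun k =>
    ⟨Finset.univ.sup k + 1, by
      simpa [Fintype.mem_piFinset, Nat.lt_succ_iff] using fun i =>
        Finset.le_sup (f := k) (Finset.mem_univ i)⟩
  have htop := Filter.tendsto_atTop_finset_of_monotone hmono hexh
  have hs : Summable fun k : ι → ℕ => ∏ i, z i ^ k i / (Nat.factorial (k i) : ℂ) := by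
    refine Summable.of_norm (summable_of_sum_le (c := Real.exp (∑ i, ‖z i‖))
      (fun _ => norm_nonneg _) fun s => ?_)
    obtain ⟨N, hN⟩ := (htop.eventually (Filter.eventually_ge_atTop s)).exists
    refine (Finset.sum_le_sum_of_subset_of_nonneg hN fun _ _ _ => norm_nonneg _).trans ?_
    simp only [norm_prod, norm_div, norm_pow, Complex.norm_natCast]
    rw [← Finset.prod_univ_sum (fun _ : ι => Finset.range N)
      (fun i j => ‖z i‖ ^ j / (Nat.factorial j : ℝ)), Real.exp_sum]
    exact Finset.prod_le_prod (fun i _ => by positivity) fun i _ =>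
      Real.sum_le_exp_of_nonneg (by positivity) N
  have h1 := hs.hasSum.comp htop
  have h2 : Filter.Tendsto (fun N : ℕ => ∏ i, ∑ j ∈ Finset.range N,
      z i ^ j / (Nat.factorial j : ℂ)) Filter.atTop (nhds (∏ i, Complex.exp (z i))) := by
    refine tendsto_finsetProd _ fun i _ => ?_
    rw [Complex.exp_eq_exp_ℂ]
    exact (NormedSpace.expSeries_div_hasSum_exp (z i)).tendsto_sum_nat
  simp only [Function.comp_def] at h1
  rw [Complex.exp_sum]
  convert hs.hasSum using 1
  refine tendsto_nhds_unique h2 (h1.congr fun N => ?_)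
  exact (Finset.prod_univ_sum (fun _ : ι => Finset.range N)
      (fun i j => z i ^ j / (Nat.factorial j : ℂ))).symm

theorem coherent_apply {ι : Type} [Fintype ι] (α : ι → ℂ) (k : ι → ℕ) :
    coherent α k = coherentCoeff α k := rfl

theorem inner_coherent {ι : Type} [Fintype ι] (α β : ι → ℂ) :
    ⟪coherent α, coherent β⟫_ℂ = (Real.exp (-(∑ i, ‖α i‖ ^ 2) / 2) : ℂ) *
      (Real.exp (-(∑ i, ‖β i‖ ^ 2) / 2) : ℂ) *
        Complex.exp (∑ i, (starRingEnd ℂ) (α i) * β i) := by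
  have h := (hasSum_multi_exp fun i => (starRingEnd ℂ) (α i) * β i).mul_left
    ((Real.exp (-(∑ i, ‖α i‖ ^ 2) / 2) : ℂ) * (Real.exp (-(∑ i, ‖β i‖ ^ 2) / 2) : ℂ))
  refine (lp.hasSum_inner (𝕜 := ℂ) (coherent α) (coherent β)).unique (h.congr_fun fun k => ?_)
  rw [coherent_apply, coherent_apply, RCLike.inner_apply', coherentCoeff, coherentCoeff, map_mul,
    Complex.conj_ofReal, map_prod, mul_mul_mul_comm, ← Finset.prod_mul_distrib]
  congr 1
  refine Finset.prod_congr rfl fun i _ => ?_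
  have hs : (Real.sqrt (Nat.factorial (k i)) : ℂ) * (Real.sqrt (Nat.factorial (k i)) : ℂ)
      = (Nat.factorial (k i) : ℂ) := by
    rw [← Complex.ofReal_mul, Real.mul_self_sqrt (Nat.cast_nonneg _), Complex.ofReal_natCast]
  rw [map_div₀, Complex.conj_ofReal, map_pow, div_mul_div_comm, hs, mul_pow]

theorem norm_coherent {ι : Type} [Fintype ι] (α : ι → ℂ) : ‖coherent α‖ = 1 := by
  have h := inner_coherent α α
  have h2 : (∑ i, (starRingEnd ℂ) (α i) * α i) = ((∑ i, ‖α i‖ ^ 2 : ℝ) : ℂ) := by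
    push_cast
    exact Finset.sum_congr rfl fun i _ => Complex.conj_mul' (α i)
  rw [h2, ← Complex.ofReal_exp, ← Complex.ofReal_mul, ← Complex.ofReal_mul, ← Real.exp_add,
    ← Real.exp_add, inner_self_eq_norm_sq_to_K] at h
  have h3 : ‖coherent α‖ ^ 2 = 1 := by
    rw [← Real.exp_zero]
    have : ‖coherent α‖ ^ 2 = Real.exp (-(∑ i, ‖α i‖ ^ 2) / 2 + -(∑ i, ‖α i‖ ^ 2) / 2 +
      ∑ i, ‖α i‖ ^ 2) := Complex.ofReal_injective (by
        rw [Complex.ofReal_pow]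
        exact h)
    rw [this]
    congr 1
    ring
  exact (pow_eq_one_iff_of_nonneg (norm_nonneg _) two_ne_zero).1 h3

theorem norm_inner_coherent {ι : Type} [Fintype ι] (α β : ι → ℂ) :
    ‖⟪coherent α, coherent β⟫_ℂ‖ = Real.exp (-(∑ i, ‖α i - β i‖ ^ 2) / 2) := by
  rw [inner_coherent, norm_mul, norm_mul, Complex.norm_real, Complex.norm_real, Complex.norm_exp,
    Real.norm_of_nonneg (Real.exp_pos _).le, Real.norm_of_nonneg (Real.exp_pos _).le,
    ← Real.exp_add, ← Real.exp_add]
  congr 1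
  have h : ∀ i, ‖α i - β i‖ ^ 2 = ‖α i‖ ^ 2 + ‖β i‖ ^ 2
      - 2 * ((starRingEnd ℂ) (α i) * β i).re := fun i => by
    rw [← Complex.normSq_eq_norm_sq, ← Complex.normSq_eq_norm_sq, ← Complex.normSq_eq_norm_sq,
      Complex.normSq_sub]
    simp
  simp only [h, Finset.sum_sub_distrib, Finset.sum_add_distrib, ← Finset.mul_sum, Complex.re_sum]
  ring

theorem continuous_coherent {ι : Type} [Fintype ι] :
    Continuous (coherent : (ι → ℂ) → Fock ι) := by
  refine continuous_iff_continuousAt.2 fun β => ?_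
  have h1 : ∀ α : ι → ℂ, ‖coherent α - coherent β‖ ^ 2
      = 2 - 2 * (⟪coherent α, coherent β⟫_ℂ).re := fun α => by
    rw [@norm_sub_sq ℂ, norm_coherent, norm_coherent]
    simp
    ring
  have h2 : Continuous fun α : ι → ℂ => ‖coherent α - coherent β‖ ^ 2 := by
    simp only [h1, inner_coherent]
    fun_prop
  refine tendsto_iff_norm_sub_tendsto_zero.2 ?_
  have h3 := (h2.sqrt).tendsto β
  simpa [Real.sqrt_sq (norm_nonneg _)] using h3

theorem coherent_sumElim {ι κ : Type} [Fintype ι] [Fintype κ] (α : ι → ℂ) (β : κ → ℂ) :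
    coherent (Sum.elim α β) = tensorVec (coherent α) (coherent β) := by
  ext k
  change coherentCoeff (Sum.elim α β) k = coherentCoeff α (splitModes ι κ k).1 *
    coherentCoeff β (splitModes ι κ k).2
  rw [coherentCoeff, coherentCoeff, coherentCoeff, mul_mul_mul_comm, Fintype.prod_sum_type,
    Fintype.sum_sum_type, ← Complex.ofReal_mul, ← Real.exp_add]
  congr 3
  simp
  ring

theorem annihilate_coherent {ι : Type} [Fintype ι] [DecidableEq ι] (i : ι) (α : ι → ℂ) :
    annihilate i (coherent α) = α i • (coherent α : (ι → ℕ) → ℂ) := by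
  funext k
  change (Real.sqrt (k i + 1) : ℂ) * coherentCoeff α (k + Pi.single i 1)
    = α i * coherentCoeff α k
  have h0 : (Real.sqrt (k i + 1) : ℂ) ≠ 0 := by
    rw [Complex.ofReal_ne_zero]
    positivity
  have h1 : (Real.sqrt (Nat.factorial (k i)) : ℂ) ≠ 0 := by
    rw [Complex.ofReal_ne_zero]
    positivity
  have h2 : (Real.sqrt (Nat.factorial (k i + 1)) : ℂ) =
      (Real.sqrt (k i + 1) : ℂ) * (Real.sqrt (Nat.factorial (k i)) : ℂ) := by
    rw [Nat.factorial_succ, Nat.cast_mul, Real.sqrt_mul (by positivity)]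
    push_cast
    rfl
  rw [coherentCoeff, coherentCoeff, ← Finset.mul_prod_erase _ _ (Finset.mem_univ i),
    ← Finset.mul_prod_erase _ (fun j => α j ^ k j / (Real.sqrt (Nat.factorial (k j)) : ℂ))
      (Finset.mem_univ i)]
  have h3 : ∏ j ∈ Finset.univ.erase i, α j ^ (k + Pi.single i 1 : ι → ℕ) j /
      (Real.sqrt (Nat.factorial ((k + Pi.single i 1 : ι → ℕ) j)) : ℂ)
      = ∏ j ∈ Finset.univ.erase i, α j ^ k j / (Real.sqrt (Nat.factorial (k j)) : ℂ) := by
    refine Finset.prod_congr rfl fun j hj => ?_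
    rw [Pi.add_apply, Pi.single_eq_of_ne (Finset.ne_of_mem_erase hj), add_zero]
  rw [h3, Pi.add_apply, Pi.single_eq_same, h2, pow_succ]
  field_simp

/-- A joint eigenvector of the annihilation operators is a multiple of a coherent state. -/
theorem eq_smul_coherent_of_annihilate {ι : Type} [Fintype ι] [DecidableEq ι] (ψ : Fock ι)
    (β : ι → ℂ) (h : ∀ i, annihilate i ψ = β i • (ψ : (ι → ℕ) → ℂ)) :
    ∃ c : ℂ, ψ = c • coherent β := by
  have h0 : coherentCoeff β 0 ≠ 0 := by
    simp [coherentCoeff]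
  refine ⟨ψ 0 / coherentCoeff β 0, ?_⟩
  -- The eigenvalue equations determine the coordinate at `l + Pi.single i 1` from that at `l`, so
  -- the vacuum coordinate fixes everything. The coherent state obeys the same recursion; the
  -- induction is on the total photon number.
  have key : ∀ (N : ℕ) (k : ι → ℕ), ∑ i, k i = N →
      ψ k = ψ 0 / coherentCoeff β 0 * coherentCoeff β k := by
    intro N
    induction N with
    | zero =>
      intro k hk
      have : k = 0 := by
        funext i
        exact (Finset.sum_eq_zero_iff.1 hk) i (Finset.mem_univ i)
      rw [this]
      field_simp
    | succ N ih =>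
      intro k hk
      obtain ⟨i, hi⟩ : ∃ i, k i ≠ 0 := by
        by_contra! hcon
        simp [hcon] at hk
      obtain ⟨l, rfl⟩ : ∃ l : ι → ℕ, k = l + Pi.single i 1 := by
        refine ⟨k - Pi.single i 1, ?_⟩
        funext j
        by_cases hj : j = i
        · subst hj
          simp
          omega
        · simp [hj]
      have hl : ∑ j, l j = N := by
        simp only [Pi.add_apply, Finset.sum_add_distrib] at hk
        rw [Finset.sum_pi_single' ] at hk
        simpa using hk
      have hs : (Real.sqrt (l i + 1) : ℂ) ≠ 0 := by
        rw [Complex.ofReal_ne_zero]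
        positivity
      have e1 : (Real.sqrt (l i + 1) : ℂ) * ψ (l + Pi.single i 1) = β i * ψ l :=
        congrFun (h i) l
      have e2 : (Real.sqrt (l i + 1) : ℂ) * coherentCoeff β (l + Pi.single i 1)
        = β i * coherentCoeff β l := congrFun (annihilate_coherent i β) l
      refine mul_left_cancel₀ hs ?_
      rw [e1, ih l hl]
      linear_combination (-(ψ 0 / coherentCoeff β 0)) * e2
  ext k
  exact key _ k rfl

/-! ### Passive linear unitaries -/

/-- A passive linear unitary maps coherent states to coherent states, by an isometry of the
amplitudes. -/
theorem IsPassiveLinear.exists_map_coherent {ι κ : Type} [Fintype ι] [DecidableEq ι] [Fintype κ]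
    [DecidableEq κ] {U : Fock ι ≃ₗᵢ[ℂ] Fock κ} (hU : IsPassiveLinear U) :
    ∃ (V : Matrix κ ι ℂ) (c : (ι → ℂ) → ℂ),
      (∀ γ, U (coherent γ) = c γ • coherent (V.mulVec γ)) ∧
      ∀ γ, ∑ i, ‖V.mulVec γ i‖ ^ 2 = ∑ i, ‖γ i‖ ^ 2 := by
  obtain ⟨V, hV⟩ := hU.linear
  have h1 : ∀ γ : ι → ℂ, ∃ c : ℂ, U (coherent γ) = c • coherent (V.mulVec γ) := by
    intro γ
    refine eq_smul_coherent_of_annihilate _ _ fun i => ?_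
    rw [hV (coherent γ) (fun j => γ j • coherent γ) (fun j => (annihilate_coherent j γ).symm) i]
    have h2 : ∑ j, V i j • U (γ j • coherent γ) = V.mulVec γ i • U (coherent γ) := by
      simp only [map_smul, smul_smul, ← Finset.sum_smul]
      rfl
    rw [h2]
    rfl
  choose c hc using h1
  have hc1 : ∀ γ, ‖c γ‖ = 1 := fun γ => by
    have h := congrArg norm (hc γ)
    rw [U.norm_map, norm_smul, norm_coherent, norm_coherent, mul_one] at h
    exact h.symm
  refine ⟨V, c, hc, fun γ => ?_⟩
  -- `U` fixes the vacuum up to a phase, and `|⟨γ|0⟩| = exp (-|γ|²/2)`; preservation of this overlap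
  -- gives `|Vγ| = |γ|`.
  have h3 := norm_inner_coherent γ 0
  rw [← U.inner_map_map, hc, hc, inner_smul_left, inner_smul_right, norm_mul, norm_mul,
    RCLike.norm_conj, hc1, hc1, one_mul, one_mul, norm_inner_coherent, Real.exp_eq_exp,
    Matrix.mulVec_zero] at h3
  simp only [Pi.zero_apply, sub_zero] at h3
  linarith

/-! ### Contractions -/

/-- A singular value `s` has an eigenvector `v` of `T†T` with eigenvalue `s²`, so `s²‖v‖² = ‖Tv‖² ≤
‖v‖²`. Beyond the dimension of `E` the singular values are `0` by convention. -/
theorem singularValues_le_one {E F : Type*} [NormedAddCommGroup E] [InnerProductSpace ℂ E]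
    [FiniteDimensional ℂ E] [NormedAddCommGroup F] [InnerProductSpace ℂ F]
    [FiniteDimensional ℂ F] (T : E →ₗ[ℂ] F) (h : ∀ x, ‖T x‖ ≤ ‖x‖) (i : ℕ) :
    T.singularValues i ≤ 1 := by
  by_cases hi : i < Module.finrank ℂ E
  · obtain ⟨v, hv⟩ := (T.hasEigenvalue_adjoint_comp_self_sq_singularValues hi).exists_hasEigenvector
    have hv0 : 0 < ‖v‖ := norm_pos_iff.2 hv.2
    have h4 : ⟪v, (LinearMap.adjoint T ∘ₗ T) v⟫_ℂ = ⟪T v, T v⟫_ℂ := by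
      rw [LinearMap.comp_apply]
      exact LinearMap.adjoint_inner_right T v (T v)
    rw [hv.apply_eq_smul, inner_smul_right, inner_self_eq_norm_sq_to_K,
      inner_self_eq_norm_sq_to_K] at h4
    have h3 : T.singularValues i ^ 2 * ‖v‖ ^ 2 = ‖T v‖ ^ 2 :=
      Complex.ofReal_injective (by push_cast; simpa using h4)
    have h5 : ‖T v‖ ^ 2 ≤ ‖v‖ ^ 2 := pow_le_pow_left₀ (norm_nonneg _) (h v) 2
    have h6 : T.singularValues i ^ 2 ≤ 1 :=
      le_of_mul_le_mul_right (by linarith) (pow_pos hv0 2)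
    exact (sq_le_one_iff₀ (LinearMap.singularValues_nonneg _ _)).1 h6
  · rw [LinearMap.singularValues_of_finrank_le _ (not_lt.1 hi)]
    exact zero_le_one

theorem isContraction_of_sum_sq_le {n n' : ℕ} {M : Matrix (Fin n') (Fin n) ℂ}
    (h : ∀ x : Fin n → ℂ, ∑ i, ‖M.mulVec x i‖ ^ 2 ≤ ∑ i, ‖x i‖ ^ 2) : IsContraction M := by
  refine singularValues_le_one _ fun v => ?_
  refine le_of_sq_le_sq ?_ (norm_nonneg _)
  rw [EuclideanSpace.norm_sq_eq, EuclideanSpace.norm_sq_eq]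
  exact h v.ofLp

/-! ### Kraus families -/

theorem inner_apply_polarization {H : Type*} [NormedAddCommGroup H] [InnerProductSpace ℂ H]
    (T : H →L[ℂ] H) (x y : H) :
    ⟪x, T y⟫_ℂ = (⟪x + y, T (x + y)⟫_ℂ - ⟪x - y, T (x - y)⟫_ℂ -
      Complex.I * ⟪x + Complex.I • y, T (x + Complex.I • y)⟫_ℂ +
      Complex.I * ⟪x - Complex.I • y, T (x - Complex.I • y)⟫_ℂ) / 4 := by
  simp only [map_add, map_sub, map_smul, inner_add_left, inner_add_right, inner_sub_left,
    inner_sub_right, inner_smul_left, inner_smul_right, Complex.conj_I]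
  linear_combination (2⁻¹ * ⟪x, T y⟫_ℂ - 2⁻¹ * ⟪y, T x⟫_ℂ) * Complex.I_sq

theorem isPositive_of_inner_nonneg {H : Type*} [NormedAddCommGroup H] [InnerProductSpace ℂ H]
    [CompleteSpace H] {T : H →L[ℂ] H} (h : ∀ x, 0 ≤ ⟪x, T x⟫_ℂ) : T.IsPositive := by
  refine (ContinuousLinearMap.isPositive_iff_complex T).2 fun x => ?_
  have h1 : ⟪T x, x⟫_ℂ = ((⟪x, T x⟫_ℂ).re : ℂ) := by
    rw [← inner_conj_symm, Complex.eq_coe_norm_of_nonneg (h x),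
      Complex.conj_ofReal, Complex.ofReal_re]
  rw [h1]
  exact ⟨rfl, (Complex.nonneg_iff.1 (h x)).1⟩

theorem inner_eq_ofReal_norm {H : Type*} [NormedAddCommGroup H] [InnerProductSpace ℂ H]
    [CompleteSpace H] {T : H →L[ℂ] H} (h : T.IsPositive) (x : H) :
    ⟪x, T x⟫_ℂ = (‖⟪x, T x⟫_ℂ‖ : ℂ) :=
  Complex.eq_coe_norm_of_nonneg (h.inner_nonneg_right x)

/-- A Kraus family can be tested on positive trace class operators and on diagonal matrix
elements. -/
theorem IsKrausFamily.of_positive {n n' : ℕ} {A : Op n n'} {Ω : Type} [MeasurableSpace Ω]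
    {μ : Measure Ω} {K : Ω → Fock (Fin n) →L[ℂ] Fock (Fin n')}
    (hK : ∀ (ψ : Fock (Fin n)) (φ : Fock (Fin n')), Measurable fun ω => ⟪φ, K ω ψ⟫_ℂ)
    (h : ∀ ρ : TraceClass (Fin n), ρ.1.IsPositive →
      (Summable fun k => ⟪numberState k, ρ.1 (numberState k)⟫_ℂ) → ∀ φ,
      Integrable (fun ω => ⟪φ, (K ω ∘L ρ.1 ∘L ContinuousLinearMap.adjoint (K ω)) φ⟫_ℂ) μ ∧
      ⟪φ, (A ρ).1 φ⟫_ℂ =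
        ∫ ω, ⟪φ, (K ω ∘L ρ.1 ∘L ContinuousLinearMap.adjoint (K ω)) φ⟫_ℂ ∂μ) :
    IsKrausFamily A μ K := by
  have hdiag : ∀ (ρ : TraceClass (Fin n)) φ,
      Integrable (fun ω => ⟪φ, (K ω ∘L ρ.1 ∘L ContinuousLinearMap.adjoint (K ω)) φ⟫_ℂ) μ ∧
      ⟪φ, (A ρ).1 φ⟫_ℂ =
        ∫ ω, ⟪φ, (K ω ∘L ρ.1 ∘L ContinuousLinearMap.adjoint (K ω)) φ⟫_ℂ ∂μ := by
    -- Trace class operators are spanned by the positive ones of finite trace, and both claims are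
    -- linear in `ρ`. Polarization then passes from diagonal to general matrix elements.
    rintro ⟨ρ, hρ⟩
    induction hρ using Submodule.span_induction with
    | mem x hx => exact h ⟨x, Submodule.subset_span hx⟩ hx.1 hx.2
    | zero =>
      intro φ
      have h0 : A ⟨0, Submodule.zero_mem _⟩ = 0 := map_zero A
      simp [h0]
    | add x y hx hy ihx ihy =>
      intro φ
      have h0 : A ⟨x + y, Submodule.add_mem _ hx hy⟩ = A ⟨x, hx⟩ + A ⟨y, hy⟩ :=
        map_add A ⟨x, hx⟩ ⟨y, hy⟩
      have h1 : ∀ ω, ⟪φ, (K ω ∘L (x + y) ∘L ContinuousLinearMap.adjoint (K ω)) φ⟫_ℂ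
          = ⟪φ, (K ω ∘L x ∘L ContinuousLinearMap.adjoint (K ω)) φ⟫_ℂ +
            ⟪φ, (K ω ∘L y ∘L ContinuousLinearMap.adjoint (K ω)) φ⟫_ℂ := fun ω => by
        simp
      simp only [h1]
      refine ⟨(ihx φ).1.add (ihy φ).1, ?_⟩
      rw [integral_add (ihx φ).1 (ihy φ).1, ← (ihx φ).2, ← (ihy φ).2, h0, ← inner_add_right]
      rfl
    | smul a x hx ih =>
      intro φ
      have h0 : A ⟨a • x, Submodule.smul_mem _ a hx⟩ = a • A ⟨x, hx⟩ := map_smul A a ⟨x, hx⟩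
      have h1 : ∀ ω, ⟪φ, (K ω ∘L (a • x) ∘L ContinuousLinearMap.adjoint (K ω)) φ⟫_ℂ
          = a * ⟪φ, (K ω ∘L x ∘L ContinuousLinearMap.adjoint (K ω)) φ⟫_ℂ := fun ω => by
        simp
      simp only [h1]
      refine ⟨(ih φ).1.const_mul a, ?_⟩
      rw [integral_const_mul, ← (ih φ).2, h0, ← inner_smul_right]
      rfl
  have hint : ∀ (ρ : TraceClass (Fin n)) (φ φ' : Fock (Fin n')), Integrable (fun ω =>
      ⟪φ, (K ω ∘L ρ.1 ∘L ContinuousLinearMap.adjoint (K ω)) φ'⟫_ℂ) μ := fun ρ φ φ' => by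
    have h1 := fun ω => inner_apply_polarization
      (K ω ∘L ρ.1 ∘L ContinuousLinearMap.adjoint (K ω)) φ φ'
    rw [funext h1]
    exact ((((hdiag ρ _).1.sub (hdiag ρ _).1).sub ((hdiag ρ _).1.const_mul _)).add
      ((hdiag ρ _).1.const_mul _)).div_const 4
  refine ⟨hK, hint, fun ρ φ φ' => ?_⟩
  have h1 := fun ω => inner_apply_polarization
    (K ω ∘L ρ.1 ∘L ContinuousLinearMap.adjoint (K ω)) φ φ'
  rw [inner_apply_polarization, funext h1, integral_div, integral_add, integral_sub,
    integral_sub, integral_const_mul, integral_const_mul, ← (hdiag ρ _).2, ← (hdiag ρ _).2,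
    ← (hdiag ρ _).2, ← (hdiag ρ _).2]
  · exact (hdiag ρ _).1
  · exact (hdiag ρ _).1
  · exact (hdiag ρ _).1.sub (hdiag ρ _).1
  · exact (hdiag ρ _).1.const_mul _
  · exact ((hdiag ρ _).1.sub (hdiag ρ _).1).sub ((hdiag ρ _).1.const_mul _)
  · exact (hdiag ρ _).1.const_mul _

/-- The matrix element equals `⟨K†φ, ρ K†φ'⟩`, in which both vectors vary with `ω`; weak
measurability of `K†` follows from that of `K` by conjugation. -/
theorem measurable_inner_kraus {n n' : ℕ} {Ω : Type} [MeasurableSpace Ω]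
    {K : Ω → Fock (Fin n) →L[ℂ] Fock (Fin n')}
    (hK : ∀ (ψ : Fock (Fin n)) (φ : Fock (Fin n')), Measurable fun ω => ⟪φ, K ω ψ⟫_ℂ)
    (ρ : Fock (Fin n) →L[ℂ] Fock (Fin n)) (φ φ' : Fock (Fin n')) :
    Measurable fun ω => ⟪φ, (K ω ∘L ρ ∘L ContinuousLinearMap.adjoint (K ω)) φ'⟫_ℂ := by
  have hadj : ∀ ψ φ, Measurable fun ω => ⟪ψ, ContinuousLinearMap.adjoint (K ω) φ⟫_ℂ :=
    fun ψ φ => by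
    have h1 : ∀ ω, ⟪ψ, ContinuousLinearMap.adjoint (K ω) φ⟫_ℂ
        = (starRingEnd ℂ) ⟪φ, K ω ψ⟫_ℂ := fun ω => by
      rw [ContinuousLinearMap.adjoint_inner_right, inner_conj_symm]
    rw [funext h1]
    exact (Complex.continuous_conj.measurable).comp (hK ψ φ)
  have h : ∀ ω, ⟪φ, (K ω ∘L ρ ∘L ContinuousLinearMap.adjoint (K ω)) φ'⟫_ℂ =
      ⟪ContinuousLinearMap.adjoint (K ω) φ, ρ (ContinuousLinearMap.adjoint (K ω) φ')⟫_ℂ :=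
    fun ω => by
    rw [ContinuousLinearMap.adjoint_inner_left]
    rfl
  rw [funext h]
  refine measurable_inner_of_weak (fun k => hadj _ _) fun k => ?_
  have h2 : ∀ ω, ⟪numberState k, ρ (ContinuousLinearMap.adjoint (K ω) φ')⟫_ℂ =
      ⟪ContinuousLinearMap.adjoint ρ (numberState k), ContinuousLinearMap.adjoint (K ω) φ'⟫_ℂ :=
    fun ω => (ContinuousLinearMap.adjoint_inner_left ρ _ _).symm
  rw [funext h2]
  exact hadj _ _

/-- For positive `ρ` the diagonal integrand is nonnegative, so one identity in `ENNReal` yields both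
integrability and the value of the integral. -/
theorem IsKrausFamily.of_lintegral {n n' : ℕ} {A : Op n n'} {Ω : Type} [MeasurableSpace Ω]
    {μ : Measure Ω} {K : Ω → Fock (Fin n) →L[ℂ] Fock (Fin n')}
    (hK : ∀ (ψ : Fock (Fin n)) (φ : Fock (Fin n')), Measurable fun ω => ⟪φ, K ω ψ⟫_ℂ)
    (h : ∀ ρ : TraceClass (Fin n), ρ.1.IsPositive →
      (Summable fun k => ⟪numberState k, ρ.1 (numberState k)⟫_ℂ) → ∀ φ,
      0 ≤ ⟪φ, (A ρ).1 φ⟫_ℂ ∧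
      ∫⁻ ω, ‖⟪φ, (K ω ∘L ρ.1 ∘L ContinuousLinearMap.adjoint (K ω)) φ⟫_ℂ‖ₑ ∂μ
        = ‖⟪φ, (A ρ).1 φ⟫_ℂ‖ₑ) :
    IsKrausFamily A μ K := by
  refine IsKrausFamily.of_positive hK fun ρ hρ hs φ => ?_
  obtain ⟨h0, h1⟩ := h ρ hρ hs φ
  have hm := measurable_inner_kraus hK ρ.1 φ φ
  refine ⟨⟨hm.aestronglyMeasurable, ?_⟩, ?_⟩
  · rw [hasFiniteIntegral_iff_enorm, h1]
    exact enorm_lt_top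
  · have h2 := fun ω => inner_eq_ofReal_norm (hρ.conj_adjoint (K ω)) φ
    rw [funext h2, integral_complex_ofReal, integral_norm_eq_lintegral_enorm
      hm.aestronglyMeasurable, h1, toReal_enorm]
    exact Complex.eq_coe_norm_of_nonneg h0

theorem IsKrausFamily.inner_nonneg {n n' : ℕ} {A : Op n n'} {Ω : Type} [MeasurableSpace Ω]
    {μ : Measure Ω} {K : Ω → Fock (Fin n) →L[ℂ] Fock (Fin n')} (h : IsKrausFamily A μ K)
    {ρ : TraceClass (Fin n)} (hρ : ρ.1.IsPositive) (φ : Fock (Fin n')) :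
    0 ≤ ⟪φ, (A ρ).1 φ⟫_ℂ := by
  have h2 := fun ω => inner_eq_ofReal_norm (hρ.conj_adjoint (K ω)) φ
  rw [h.apply_eq, funext h2, integral_complex_ofReal]
  exact Complex.zero_le_real.2 (integral_nonneg fun _ => norm_nonneg _)

theorem IsKrausFamily.lintegral_eq {n n' : ℕ} {A : Op n n'} {Ω : Type} [MeasurableSpace Ω]
    {μ : Measure Ω} {K : Ω → Fock (Fin n) →L[ℂ] Fock (Fin n')} (h : IsKrausFamily A μ K)
    {ρ : TraceClass (Fin n)} (hρ : ρ.1.IsPositive) (φ : Fock (Fin n')) :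
    ∫⁻ ω, ‖⟪φ, (K ω ∘L ρ.1 ∘L ContinuousLinearMap.adjoint (K ω)) φ⟫_ℂ‖ₑ ∂μ
        = ‖⟪φ, (A ρ).1 φ⟫_ℂ‖ₑ := by
  have h2 := fun ω => inner_eq_ofReal_norm (hρ.conj_adjoint (K ω)) φ
  rw [h.apply_eq ρ φ φ, funext h2, integral_complex_ofReal,
    ← ofReal_integral_norm_eq_lintegral_enorm (h.integrable ρ φ φ), ← ofReal_norm,
    Complex.norm_real, Real.norm_of_nonneg (integral_nonneg fun _ => norm_nonneg _)]

/-- By Tonelli, the inner integral at fixed `x` is the diagonal element of `A ρ` at `(L x)†φ`; the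
outer one is then the Kraus formula for `B` at `A ρ`, which is again positive. -/
theorem IsKrausFamily.comp {n n' n'' : ℕ} {A : Op n n'} {B : Op n' n''} {Ω Ω' : Type}
    [MeasurableSpace Ω] [MeasurableSpace Ω'] {μ : Measure Ω} {ν : Measure Ω'} [SFinite μ]
    [SFinite ν] {K : Ω → Fock (Fin n) →L[ℂ] Fock (Fin n')}
    {L : Ω' → Fock (Fin n') →L[ℂ] Fock (Fin n'')} (hA : IsKrausFamily A μ K)
    (hB : IsKrausFamily B ν L) :
    IsKrausFamily (B.comp A) (ν.prod μ) fun p => L p.1 ∘L K p.2 := by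
  have hm : ∀ (ψ : Fock (Fin n)) (φ : Fock (Fin n'')),
      Measurable fun p : Ω' × Ω => ⟪φ, (L p.1 ∘L K p.2) ψ⟫_ℂ := fun ψ φ => by
    simp only [ContinuousLinearMap.comp_apply, ← ContinuousLinearMap.adjoint_inner_left (L _)]
    refine measurable_inner_of_weak (fun k => ?_) fun k => ?_
    · simp only [ContinuousLinearMap.adjoint_inner_right, ← inner_conj_symm (L _ _) φ]
      exact (Complex.continuous_conj.measurable).comp ((hB.measurable _ φ).comp measurable_fst)
    · exact (hA.measurable ψ _).comp measurable_snd
  refine IsKrausFamily.of_lintegral hm fun ρ hρ _ φ => ?_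
  have hAρ : (A ρ).1.IsPositive := isPositive_of_inner_nonneg (hA.inner_nonneg hρ)
  refine ⟨hB.inner_nonneg hAρ φ, ?_⟩
  have h1 := (measurable_inner_kraus hm ρ.1 φ φ).enorm
  rw [lintegral_prod _ h1.aemeasurable]
  have h2 : ∀ (x : Ω'), ∫⁻ y, ‖⟪φ, ((L x ∘L K y) ∘L ρ.1 ∘L
      ContinuousLinearMap.adjoint (L x ∘L K y)) φ⟫_ℂ‖ₑ ∂μ
      = ‖⟪φ, (L x ∘L (A ρ).1 ∘L ContinuousLinearMap.adjoint (L x)) φ⟫_ℂ‖ₑ := fun x => by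
    have h3 := hA.lintegral_eq hρ (ContinuousLinearMap.adjoint (L x) φ)
    rw [ContinuousLinearMap.adjoint_inner_left] at h3
    rw [ContinuousLinearMap.comp_apply, ContinuousLinearMap.comp_apply, ← h3]
    refine lintegral_congr fun y => ?_
    rw [ContinuousLinearMap.adjoint_comp, ContinuousLinearMap.adjoint_inner_left]
    rfl
  simp only [h2]
  exact hB.lintegral_eq hAρ φ

/-! ### Countable sums -/

theorem measurableSet_sigma_iff {X : Type*} {Ω : X → Type*} [∀ x, MeasurableSpace (Ω x)]
    {s : Set (Σ x, Ω x)} : MeasurableSet s ↔ ∀ x, MeasurableSet (Sigma.mk x ⁻¹' s) :=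
  MeasurableSpace.measurableSet_iInf

theorem measurable_sigmaMk {X : Type*} {Ω : X → Type*} [∀ x, MeasurableSpace (Ω x)] (x : X) :
    Measurable (Sigma.mk x : Ω x → Σ x, Ω x) := fun _ hs => measurableSet_sigma_iff.1 hs x

theorem measurable_of_sigmaMk {X β : Type*} {Ω : X → Type*} [∀ x, MeasurableSpace (Ω x)]
    [MeasurableSpace β] {f : (Σ x, Ω x) → β} (h : ∀ x, Measurable fun ω => f ⟨x, ω⟩) :
    Measurable f := fun _ hs => measurableSet_sigma_iff.2 fun x => h x hs

/-- The disjoint union of measures. -/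
def sigmaMeasure {X : Type*} {Ω : X → Type*} [∀ x, MeasurableSpace (Ω x)]
    (μ : ∀ x, Measure (Ω x)) : Measure (Σ x, Ω x) :=
  Measure.sum fun x => (μ x).map (Sigma.mk x)

theorem sigmaMeasure_image_mk {X : Type*} {Ω : X → Type*} [∀ x, MeasurableSpace (Ω x)]
    (μ : ∀ x, Measure (Ω x)) (x : X) {s : Set (Ω x)} (hs : MeasurableSet s) :
    sigmaMeasure μ (Sigma.mk x '' s) = μ x s := by
  have h1 : Sigma.mk x ⁻¹' (Sigma.mk x '' s) = s :=
    Set.preimage_image_eq s sigma_mk_injective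
  have h2 : ∀ y, y ≠ x → (Sigma.mk y : Ω y → _) ⁻¹' (Sigma.mk x '' s) = ∅ := fun y hy => by
    ext ω
    simp only [Set.mem_preimage, Set.mem_image, Sigma.mk.injEq, Set.mem_empty_iff_false,
      iff_false, not_exists, not_and]
    exact fun _ _ h => absurd h.symm hy
  have hm : MeasurableSet (Sigma.mk x '' s : Set (Σ x, Ω x)) := by
    refine measurableSet_sigma_iff.2 fun y => ?_
    by_cases hy : y = x
    · subst hy
      rwa [h1]
    · rw [h2 y hy]
      exact MeasurableSet.empty
  rw [sigmaMeasure, Measure.sum_apply _ hm, tsum_eq_single x fun y hy => by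
    rw [Measure.map_apply (measurable_sigmaMk y) hm, h2 y hy, measure_empty],
    Measure.map_apply (measurable_sigmaMk x) hm, h1]

instance sigmaFinite_sigmaMeasure {X : Type*} [Countable X] {Ω : X → Type*}
    [∀ x, MeasurableSpace (Ω x)] (μ : ∀ x, Measure (Ω x)) [∀ x, SigmaFinite (μ x)] :
    SigmaFinite (sigmaMeasure μ) := by
  -- The spanning sets of all the summands together form a countable cover by sets of finite
  -- measure.
  refine Measure.sigmaFinite_of_countable (S := Set.range fun p : X × ℕ =>
    Sigma.mk p.1 '' spanningSets (μ p.1) p.2) (Set.countable_range _) ?_ ?_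
  · rintro _ ⟨⟨x, i⟩, rfl⟩
    rw [sigmaMeasure_image_mk μ x (measurableSet_spanningSets (μ x) i)]
    exact measure_spanningSets_lt_top (μ x) i
  · refine Set.eq_univ_of_forall fun ⟨x, ω⟩ => ?_
    exact ⟨_, ⟨(x, spanningSetsIndex (μ x) ω), rfl⟩, ω, mem_spanningSetsIndex (μ x) ω, rfl⟩

theorem lintegral_sigmaMeasure {X : Type*} {Ω : X → Type*}
    [∀ x, MeasurableSpace (Ω x)] (μ : ∀ x, Measure (Ω x)) {f : (Σ x, Ω x) → ENNReal}
    (hf : Measurable f) : ∫⁻ s, f s ∂(sigmaMeasure μ) = ∑' x, ∫⁻ ω, f ⟨x, ω⟩ ∂(μ x) := by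
  rw [sigmaMeasure, lintegral_sum_measure]
  exact tsum_congr fun x => lintegral_map hf (measurable_sigmaMk x)

/-- On positive `ρ` and diagonal elements the given sums have nonnegative terms, so they agree with
`ENNReal` sums, that is, with the integral over the disjoint union. -/
theorem IsKrausFamily.sum {n n' : ℕ} {X : Type} {A : X → Op n n'} {A' : Op n n'}
    {Ω : X → Type} [∀ x, MeasurableSpace (Ω x)] {μ : ∀ x, Measure (Ω x)}
    {K : ∀ x, Ω x → Fock (Fin n) →L[ℂ] Fock (Fin n')} (hA : ∀ x, IsKrausFamily (A x) (μ x) (K x))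
    (h : ∀ (ρ : TraceClass (Fin n)) (φ φ' : Fock (Fin n')),
      HasSum (fun x => ⟪φ, (A x ρ).1 φ'⟫_ℂ) ⟪φ, (A' ρ).1 φ'⟫_ℂ) :
    IsKrausFamily A' (sigmaMeasure μ) fun s => K s.1 s.2 := by
  have hm : ∀ (ψ : Fock (Fin n)) (φ : Fock (Fin n')),
      Measurable fun s : Σ x, Ω x => ⟪φ, K s.1 s.2 ψ⟫_ℂ := fun ψ φ =>
    measurable_of_sigmaMk fun x => (hA x).measurable ψ φ
  refine IsKrausFamily.of_lintegral hm fun ρ hρ _ φ => ?_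
  have h0 : ∀ x, ⟪φ, (A x ρ).1 φ⟫_ℂ = (‖⟪φ, (A x ρ).1 φ⟫_ℂ‖ : ℂ) := fun x =>
    Complex.eq_coe_norm_of_nonneg ((hA x).inner_nonneg hρ φ)
  have h1 := h ρ φ φ
  have h2 : Summable fun x => ‖⟪φ, (A x ρ).1 φ⟫_ℂ‖ := h1.summable.norm
  have h3 : ⟪φ, (A' ρ).1 φ⟫_ℂ = ((∑' x, ‖⟪φ, (A x ρ).1 φ⟫_ℂ‖ : ℝ) : ℂ) := by
    rw [funext h0] at h1
    exact h1.unique (Complex.hasSum_ofReal.2 h2.hasSum)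
  have h4 : 0 ≤ ∑' x, ‖⟪φ, (A x ρ).1 φ⟫_ℂ‖ := tsum_nonneg fun _ => norm_nonneg _
  rw [lintegral_sigmaMeasure _ (measurable_inner_kraus hm ρ.1 φ φ).enorm, h3]
  refine ⟨Complex.zero_le_real.2 h4, ?_⟩
  simp only [fun x => (hA x).lintegral_eq hρ φ]
  rw [← ofReal_norm, Complex.norm_real, Real.norm_of_nonneg h4,
    ENNReal.ofReal_tsum_of_nonneg (fun _ => norm_nonneg _) h2]
  simp only [ofReal_norm]

/-! ### Integrals of rank one operators -/

section Gram

variable {Ω : Type} [MeasurableSpace Ω] {ν : Measure Ω} {H : Type*} [NormedAddCommGroup H]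
  [InnerProductSpace ℂ H] {χ : Ω → H}

theorem measurable_inner_right_of_left (hm : ∀ v, Measurable fun ω => ⟪χ ω, v⟫_ℂ) (u : H) :
    Measurable fun ω => ⟪u, χ ω⟫_ℂ := by
  have h : ∀ ω, ⟪u, χ ω⟫_ℂ = (starRingEnd ℂ) ⟪χ ω, u⟫_ℂ := fun ω => (inner_conj_symm _ _).symm
  rw [funext h]
  exact (Complex.continuous_conj.measurable).comp (hm u)

theorem norm_inner_mul_inner_le (u v x : H) :
    ‖⟪u, x⟫_ℂ * ⟪x, v⟫_ℂ‖ ≤ ‖u‖ * ‖v‖ * ‖x‖ ^ 2 := by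
  rw [norm_mul]
  calc ‖⟪u, x⟫_ℂ‖ * ‖⟪x, v⟫_ℂ‖ ≤ (‖u‖ * ‖x‖) * (‖x‖ * ‖v‖) :=
        mul_le_mul (norm_inner_le_norm _ _) (norm_inner_le_norm _ _) (norm_nonneg _)
          (by positivity)
    _ = ‖u‖ * ‖v‖ * ‖x‖ ^ 2 := by ring

theorem integrable_inner_mul_inner (hm : ∀ v, Measurable fun ω => ⟪χ ω, v⟫_ℂ)
    (hχ : Integrable (fun ω => ‖χ ω‖ ^ 2) ν) (u v : H) :
    Integrable (fun ω => ⟪u, χ ω⟫_ℂ * ⟪χ ω, v⟫_ℂ) ν :=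
  (hχ.const_mul (‖u‖ * ‖v‖)).mono'
    ((measurable_inner_right_of_left hm u).mul (hm v)).aestronglyMeasurable
    (Filter.Eventually.of_forall fun ω => norm_inner_mul_inner_le u v (χ ω))

/-- Cauchy–Schwarz and the integrability of `‖χ‖²` make the integral a bounded functional of `v`, so
it can be compared with others on number states alone. -/
theorem exists_clm_integral_inner_mul_inner (hm : ∀ v, Measurable fun ω => ⟪χ ω, v⟫_ℂ)
    (hχ : Integrable (fun ω => ‖χ ω‖ ^ 2) ν) (u : H) :
    ∃ f : H →L[ℂ] ℂ, ∀ v, f v = ∫ ω, ⟪u, χ ω⟫_ℂ * ⟪χ ω, v⟫_ℂ ∂ν := by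
  refine ⟨LinearMap.mkContinuous
    { toFun := fun v => ∫ ω, ⟪u, χ ω⟫_ℂ * ⟪χ ω, v⟫_ℂ ∂ν
      map_add' := fun v w => ?_
      map_smul' := fun c v => ?_ } (‖u‖ * ∫ ω, ‖χ ω‖ ^ 2 ∂ν) fun v => ?_, fun v => rfl⟩
  · simp only [inner_add_right, mul_add]
    exact integral_add (integrable_inner_mul_inner hm hχ u v)
      (integrable_inner_mul_inner hm hχ u w)
  · simp only [inner_smul_right, mul_left_comm _ c]
    exact integral_const_mul _ _
  · refine (norm_integral_le_of_norm_le (hχ.const_mul (‖u‖ * ‖v‖))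
      (Filter.Eventually.of_forall fun ω => norm_inner_mul_inner_le u v (χ ω))).trans_eq ?_
    rw [integral_const_mul]
    ring

end Gram

/-- An integral of rank one operators is determined by its matrix elements between number
states. -/
theorem inner_apply_eq_integral {ι Ω : Type} [MeasurableSpace Ω] {ν : Measure Ω} {χ : Ω → Fock ι}
    (hm : ∀ v, Measurable fun ω => ⟪χ ω, v⟫_ℂ) (hχ : Integrable (fun ω => ‖χ ω‖ ^ 2) ν)
    {T : Fock ι →L[ℂ] Fock ι}
    (h : ∀ k l, ⟪numberState k, T (numberState l)⟫_ℂ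
      = ∫ ω, ⟪numberState k, χ ω⟫_ℂ * ⟪χ ω, numberState l⟫_ℂ ∂ν) (u v : Fock ι) :
    ⟪u, T v⟫_ℂ = ∫ ω, ⟪u, χ ω⟫_ℂ * ⟪χ ω, v⟫_ℂ ∂ν := by
  -- The identity is extended first in the right argument, then, after conjugation, in the left one.
  have hk : ∀ k v, ⟪numberState k, T v⟫_ℂ = ∫ ω, ⟪numberState k, χ ω⟫_ℂ * ⟪χ ω, v⟫_ℂ ∂ν := by
    intro k v
    obtain ⟨f, hf⟩ := exists_clm_integral_inner_mul_inner hm hχ (numberState k)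
    have h1 : innerSL ℂ (numberState k) ∘L T = f :=
      clm_ext_numberState fun l => (h k l).trans (hf _).symm
    rw [← hf v, ← h1]
    rfl
  obtain ⟨f, hf⟩ := exists_clm_integral_inner_mul_inner hm hχ v
  have h1 : innerSL ℂ (T v) = f := clm_ext_numberState fun k => by
    rw [hf, innerSL_apply_apply, ← inner_conj_symm, hk, ← integral_conj]
    congr 1
    funext ω
    rw [map_mul, inner_conj_symm, inner_conj_symm, mul_comm]
  have h2 : ⟪T v, u⟫_ℂ = f u := congrArg (fun g => g u) h1
  rw [← inner_conj_symm, h2, hf, ← integral_conj]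
  congr 1
  funext ω
  rw [map_mul, inner_conj_symm, inner_conj_symm, mul_comm]

/-- A trace of `E` against an integral of rank one operators is the integral of the
expectation values of `E`. -/
theorem hasSum_integral_inner_mul_inner {κ Ω : Type} [Finite κ] [MeasurableSpace Ω]
    {ν : Measure Ω} {ξ : Ω → Fock κ} (hm : ∀ v, Measurable fun ω => ⟪ξ ω, v⟫_ℂ)
    (hξ : Integrable (fun ω => ‖ξ ω‖ ^ 2) ν) (E : Fock κ →L[ℂ] Fock κ) :
    HasSum (fun k => ∫ ω, ⟪ContinuousLinearMap.adjoint E (numberState k), ξ ω⟫_ℂ *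
      ⟪ξ ω, numberState k⟫_ℂ ∂ν) (∫ ω, ⟪ξ ω, E (ξ ω)⟫_ℂ ∂ν) := by
  have hsum : ∀ ω, HasSum (fun k => ⟪ContinuousLinearMap.adjoint E (numberState k), ξ ω⟫_ℂ *
      ⟪ξ ω, numberState k⟫_ℂ) ⟪ξ ω, E (ξ ω)⟫_ℂ := fun ω => by
    refine (hasSum_inner_numberState (ξ ω) (E (ξ ω))).congr_fun fun k => ?_
    rw [ContinuousLinearMap.adjoint_inner_left, mul_comm]
  have hint : ∀ k, Integrable (fun ω => ⟪ContinuousLinearMap.adjoint E (numberState k), ξ ω⟫_ℂ *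
      ⟪ξ ω, numberState k⟫_ℂ) ν := fun k => integrable_inner_mul_inner hm hξ _ _
  have h := hasSum_integral_of_summable_integral_norm hint ?_
  · simpa only [fun ω => (hsum ω).tsum_eq] using h
  -- Each term is at most `|⟨k, Eξ⟩|² + |⟨k, ξ⟩|²`, and by Parseval these sum to `‖Eξ‖² + ‖ξ‖²`.
  refine summable_of_sum_le (c := ∫ ω, (‖E‖ ^ 2 + 1) * ‖ξ ω‖ ^ 2 ∂ν)
    (fun k => integral_nonneg fun _ => norm_nonneg _) fun s => ?_
  rw [← integral_finsetSum s fun k _ => (hint k).norm]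
  refine integral_mono (integrable_finsetSum s fun k _ => (hint k).norm) (hξ.const_mul _)
    fun ω => ?_
  have h1 : ∀ k, ‖⟪ContinuousLinearMap.adjoint E (numberState k), ξ ω⟫_ℂ *
      ⟪ξ ω, numberState k⟫_ℂ‖ ≤ ‖⟪numberState k, E (ξ ω)⟫_ℂ‖ ^ 2 +
        ‖⟪numberState k, ξ ω⟫_ℂ‖ ^ 2 := fun k => by
    rw [ContinuousLinearMap.adjoint_inner_left, norm_mul, norm_inner_symm (ξ ω)]
    nlinarith [sq_nonneg (‖⟪numberState k, E (ξ ω)⟫_ℂ‖ - ‖⟪numberState k, ξ ω⟫_ℂ‖),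
      sq_nonneg ‖⟪numberState k, E (ξ ω)⟫_ℂ‖, sq_nonneg ‖⟪numberState k, ξ ω⟫_ℂ‖]
  have h2 := (hasSum_sq_inner_numberState (E (ξ ω))).add (hasSum_sq_inner_numberState (ξ ω))
  calc _ ≤ _ := Finset.sum_le_sum fun k _ => h1 k
    _ ≤ _ := sum_le_hasSum s (fun _ _ => by positivity) h2
    _ ≤ (‖E‖ * ‖ξ ω‖) ^ 2 + ‖ξ ω‖ ^ 2 := by
      gcongr
      exact E.le_opNorm _
    _ = (‖E‖ ^ 2 + 1) * ‖ξ ω‖ ^ 2 := by ring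

/-! ### Joining a classical ancilla -/

section Ancilla

variable {ι κ : Type} [Fintype κ]

/-- The vectors `S|i⟩ ⊗ |β⟩`. -/
def jointVec (S : Fock ι →L[ℂ] Fock ι) (p : (ι → ℕ) × (κ → ℂ)) : Fock (ι ⊕ κ) :=
  tensorVec (S (numberState p.1)) (coherent p.2)

theorem measurable_inner_jointVec [Finite ι] (S : Fock ι →L[ℂ] Fock ι) (v : Fock (ι ⊕ κ)) :
    Measurable fun p => ⟪jointVec S p, v⟫_ℂ := by
  refine measurable_from_prod_countable_right fun i => ?_
  have h : Continuous fun β : κ → ℂ => tensorLeft κ (S (numberState i)) (coherent β) :=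
    (ContinuousLinearMap.continuous _).comp continuous_coherent
  exact (h.inner continuous_const).measurable

theorem norm_jointVec (S : Fock ι →L[ℂ] Fock ι) (p : (ι → ℕ) × (κ → ℂ)) :
    ‖jointVec S p‖ = ‖S (numberState p.1)‖ := by
  rw [jointVec, norm_tensorVec, norm_coherent, mul_one]

theorem integrable_norm_jointVec_sq [Finite ι] {S : Fock ι →L[ℂ] Fock ι}
    (hS : Summable fun k => ‖S (numberState k)‖ ^ 2) (P : Measure (κ → ℂ))
    [IsFiniteMeasure P] :
    Integrable (fun p => ‖jointVec S p‖ ^ 2) (Measure.count.prod P) := by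
  simp only [norm_jointVec]
  have h : Integrable (fun k : ι → ℕ => ‖S (numberState k)‖ ^ 2) Measure.count := by
    rw [integrable_count_iff]
    exact hS.norm
  exact h.comp_fst P

/-- Here `ρ = ∑ i, S|i⟩⟨i|S` and `σ = ∫ |β⟩⟨β| dP`, so `ρ ⊗ σ` is an integral of rank one operators.
Between number states of the composite system the integral factors. The hypothesis `hS` expresses
that `ρ` has finite trace. -/
theorem inner_tensorOp_eq_integral [Finite ι] {ρ S : Fock ι →L[ℂ] Fock ι}
    (hSS : S ∘L S = ρ) (hSa : ContinuousLinearMap.adjoint S = S)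
    (hS : Summable fun k => ‖S (numberState k)‖ ^ 2) {σ : Fock κ →L[ℂ] Fock κ}
    {P : Measure (κ → ℂ)} [IsProbabilityMeasure P]
    (hP : ∀ φ φ' : Fock κ, ⟪φ, σ φ'⟫_ℂ = ∫ β, ⟪φ, proj (coherent β) φ'⟫_ℂ ∂P)
    (u v : Fock (ι ⊕ κ)) :
    ⟪u, tensorOp ρ σ v⟫_ℂ =
      ∫ p, ⟪u, jointVec S p⟫_ℂ * ⟪jointVec S p, v⟫_ℂ ∂(Measure.count.prod P) := by
  refine inner_apply_eq_integral (measurable_inner_jointVec S)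
    (integrable_norm_jointVec_sq hS P) (fun k l => ?_) u v
  rw [numberState_eq_tensorVec k, numberState_eq_tensorVec l, tensorOp_tensorVec, inner_tensorVec,
    hP]
  set k1 := (splitModes ι κ k).1
  set k2 := (splitModes ι κ k).2
  set l1 := (splitModes ι κ l).1
  set l2 := (splitModes ι κ l).2
  have h1 : ∀ p : (ι → ℕ) × (κ → ℂ),
      ⟪tensorVec (numberState k1) (numberState k2), jointVec S p⟫_ℂ *
        ⟪jointVec S p, tensorVec (numberState l1) (numberState l2)⟫_ℂ =
      (⟪numberState k1, S (numberState p.1)⟫_ℂ * ⟪S (numberState p.1), numberState l1⟫_ℂ) *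
        ⟪numberState k2, proj (coherent p.2) (numberState l2)⟫_ℂ := fun p => by
    rw [jointVec, inner_tensorVec, inner_tensorVec, proj, InnerProductSpace.rankOne_apply,
      inner_smul_right]
    ring
  rw [funext h1, integral_prod_mul (fun i => ⟪numberState k1, S (numberState i)⟫_ℂ *
    ⟪S (numberState i), numberState l1⟫_ℂ)
    (fun β => ⟪numberState k2, proj (coherent β) (numberState l2)⟫_ℂ)]
  congr 1
  have h2 := hasSum_inner_numberState (S (numberState k1)) (S (numberState l1))
  have h3 : ∀ i, ⟪S (numberState k1), numberState i⟫_ℂ * ⟪numberState i, S (numberState l1)⟫_ℂ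
      = ⟪numberState k1, S (numberState i)⟫_ℂ * ⟪S (numberState i), numberState l1⟫_ℂ :=
    fun i => by
    have ha := ContinuousLinearMap.adjoint_inner_left S (numberState i) (numberState k1)
    have hb := ContinuousLinearMap.adjoint_inner_left S (numberState l1) (numberState i)
    rw [hSa] at ha hb
    rw [ha, hb]
  rw [funext h3] at h2
  have h4 : ⟪S (numberState k1), S (numberState l1)⟫_ℂ = ⟪numberState k1, ρ (numberState l1)⟫_ℂ := by
    have ha := ContinuousLinearMap.adjoint_inner_left S (S (numberState l1)) (numberState k1)
    rw [hSa] at ha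
    rw [ha, ← hSS]
    rfl
  rw [integral_countable (integrable_count_iff.2 h2.summable.norm), ← h4, ← h2.tsum_eq]
  simp

end Ancilla

/-! ### One measurement round -/

section Round

variable {ι κ ι' κ' : Type}

/-- `(1 ⊗ ⟨χ'|) U (1 ⊗ |χ⟩)`. -/
def sandwich (U : Fock (ι ⊕ κ) ≃ₗᵢ[ℂ] Fock (ι' ⊕ κ')) (χ' : Fock κ') (χ : Fock κ) :
    Fock ι →L[ℂ] Fock ι' :=
  ContinuousLinearMap.adjoint (tensorRight ι' χ') ∘L
    (U : Fock (ι ⊕ κ) →L[ℂ] Fock (ι' ⊕ κ')) ∘L tensorRight ι χ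

theorem inner_sandwich (U : Fock (ι ⊕ κ) ≃ₗᵢ[ℂ] Fock (ι' ⊕ κ')) (χ' : Fock κ') (χ : Fock κ)
    (φ : Fock ι') (ψ : Fock ι) :
    ⟪φ, sandwich U χ' χ ψ⟫_ℂ = ⟪tensorVec φ χ', U (tensorVec ψ χ)⟫_ℂ :=
  ContinuousLinearMap.adjoint_inner_right (tensorRight ι' χ') φ (U (tensorVec ψ χ))

theorem adjoint_tensorRight_tensorVec (χ' χ : Fock κ') (ψ : Fock ι') :
    ContinuousLinearMap.adjoint (tensorRight ι' χ') (tensorVec ψ χ) = ⟪χ', χ⟫_ℂ • ψ := by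
  refine eq_of_inner_numberState fun k => ?_
  rw [ContinuousLinearMap.adjoint_inner_right, tensorRight_apply, inner_tensorVec,
    inner_smul_right, mul_comm]

theorem measurable_inner_sandwich [Finite κ'] [Fintype κ]
    (U : Fock (ι ⊕ κ) ≃ₗᵢ[ℂ] Fock (ι' ⊕ κ')) (Q : Fock κ' →L[ℂ] Fock κ') (φ : Fock ι')
    (ψ : Fock ι) : Measurable fun p : (κ' → ℕ) × (κ → ℂ) =>
      ⟪φ, sandwich U (Q (numberState p.1)) (coherent p.2) ψ⟫_ℂ := by
  simp only [inner_sandwich]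
  refine measurable_from_prod_countable_right fun j => ?_
  have h : Continuous fun β : κ → ℂ => U (tensorLeft κ ψ (coherent β)) :=
    U.continuous.comp ((ContinuousLinearMap.continuous _).comp continuous_coherent)
  exact ((innerSL ℂ (tensorVec φ (Q (numberState j)))).continuous.comp h).measurable

/-- The operation `ρ ↦ tr_{κ'} [(1 ⊗ E) U (ρ ⊗ σ) U†]` in diagonal matrix elements, for positive
`ρ = S²`, classical `σ` and `E = Q²`. -/
theorem IsPartialTrace.inner_eq_integral [Finite ι] [Fintype κ] [Finite κ']
    {ρ S : Fock ι →L[ℂ] Fock ι} (hSS : S ∘L S = ρ) (hSa : ContinuousLinearMap.adjoint S = S)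
    (hS : Summable fun k => ‖S (numberState k)‖ ^ 2) {σ : Fock κ →L[ℂ] Fock κ}
    {P : Measure (κ → ℂ)} [IsProbabilityMeasure P]
    (hP : ∀ φ φ' : Fock κ, ⟪φ, σ φ'⟫_ℂ = ∫ β, ⟪φ, proj (coherent β) φ'⟫_ℂ ∂P)
    (U : Fock (ι ⊕ κ) ≃ₗᵢ[ℂ] Fock (ι' ⊕ κ')) {E Q : Fock κ' →L[ℂ] Fock κ'}
    (hQQ : Q ∘L Q = E) (hQa : ContinuousLinearMap.adjoint Q = Q) {R : Fock ι' →L[ℂ] Fock ι'}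
    (hR : IsPartialTrace (onRight E ∘L (U : Fock (ι ⊕ κ) →L[ℂ] Fock (ι' ⊕ κ')) ∘L
      tensorOp ρ σ ∘L (U.symm : Fock (ι' ⊕ κ') →L[ℂ] Fock (ι ⊕ κ))) R) (φ : Fock ι') :
    0 ≤ ⟪φ, R φ⟫_ℂ ∧ ‖⟪φ, R φ⟫_ℂ‖ₑ = ∫⁻ p, ∑' j,
      ‖⟪tensorVec φ (Q (numberState j)), U (jointVec S p)⟫_ℂ‖ₑ ^ 2 ∂(Measure.count.prod P) := by
  set ν : Measure ((ι → ℕ) × (κ → ℂ)) := Measure.count.prod P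
  set D := ContinuousLinearMap.adjoint (tensorLeft κ' φ)
  -- `ξ p = (⟨φ| ⊗ 1) U (S|i⟩ ⊗ |β⟩)` lives on the measured modes, and the diagonal element of `R`
  -- becomes `∫ ⟨ξ, Eξ⟩ = ∫ ‖Qξ‖²`.
  obtain ⟨ξ, hξ⟩ : ∃ ξ : (ι → ℕ) × (κ → ℂ) → Fock κ', ∀ p, ξ p = D (U (jointVec S p)) :=
    ⟨_, fun _ => rfl⟩
  have hξl : ∀ p x, ⟪x, ξ p⟫_ℂ = ⟪U.symm (tensorVec φ x), jointVec S p⟫_ℂ := fun p x => by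
    rw [hξ, ← U.inner_map_map, U.apply_symm_apply]
    exact ContinuousLinearMap.adjoint_inner_right (tensorLeft κ' φ) x _
  have hξr : ∀ p x, ⟪ξ p, x⟫_ℂ = ⟪jointVec S p, U.symm (tensorVec φ x)⟫_ℂ := fun p x => by
    rw [← inner_conj_symm, hξl, inner_conj_symm]
  have hm : ∀ v, Measurable fun p => ⟪ξ p, v⟫_ℂ := fun v => by
    simp only [hξr]
    exact measurable_inner_jointVec S _
  have hmQ : Measurable fun p => ‖Q (ξ p)‖ₑ ^ 2 := by
    simp only [← tsum_enorm_sq_inner_numberState (Q _)]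
    refine Measurable.tsum fun k => (Measurable.enorm ?_).pow_const 2
    have h : ∀ p, ⟪numberState k, Q (ξ p)⟫_ℂ
        = ⟪ContinuousLinearMap.adjoint Q (numberState k), ξ p⟫_ℂ := fun p =>
      (ContinuousLinearMap.adjoint_inner_left _ _ _).symm
    simp only [h]
    exact measurable_inner_right_of_left hm _
  have hmξ : Measurable fun p => ‖ξ p‖ ^ 2 := by
    have h : ∀ p, ‖ξ p‖ ^ 2 = (‖ξ p‖ₑ ^ 2).toReal := fun p => by simp
    simp only [h, ← tsum_enorm_sq_inner_numberState (ξ _)]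
    exact (Measurable.tsum fun k =>
      ((measurable_inner_right_of_left hm _).enorm).pow_const 2).ennreal_toReal
  have hint : Integrable (fun p => ‖ξ p‖ ^ 2) ν := by
    refine ((integrable_norm_jointVec_sq hS P).const_mul (‖D‖ ^ 2)).mono'
      hmξ.aestronglyMeasurable (Filter.Eventually.of_forall fun p => ?_)
    rw [Real.norm_of_nonneg (by positivity), ← mul_pow, hξ]
    refine pow_le_pow_left₀ (norm_nonneg _) ((D.le_opNorm _).trans_eq ?_) 2
    rw [U.norm_map]
  have hEa : ContinuousLinearMap.adjoint E = E := by
    rw [← hQQ, ContinuousLinearMap.adjoint_comp, hQa]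
  have h1 := hasSum_integral_inner_mul_inner hm hint E
  have h2 := hR φ φ
  have h3 : ∀ k : κ' → ℕ, ⟪tensorVec φ (numberState k), (onRight E ∘L
      (U : Fock (ι ⊕ κ) →L[ℂ] Fock (ι' ⊕ κ')) ∘L tensorOp ρ σ ∘L
      (U.symm : Fock (ι' ⊕ κ') →L[ℂ] Fock (ι ⊕ κ))) (tensorVec φ (numberState k))⟫_ℂ =
      ∫ p, ⟪ContinuousLinearMap.adjoint E (numberState k), ξ p⟫_ℂ *
        ⟪ξ p, numberState k⟫_ℂ ∂ν := fun k => by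
    simp only [hξl, hξr]
    rw [← inner_tensorOp_eq_integral hSS hSa hS hP, ContinuousLinearMap.comp_apply,
      inner_onRight_tensorVec, ← U.inner_map_map, U.apply_symm_apply]
    rfl
  rw [funext h3] at h2
  have h4 : ∀ p, ⟪ξ p, E (ξ p)⟫_ℂ = ((‖Q (ξ p)‖ ^ 2 : ℝ) : ℂ) := fun p => by
    have ha := ContinuousLinearMap.adjoint_inner_left Q (Q (ξ p)) (ξ p)
    rw [hQa] at ha
    rw [← hQQ, ContinuousLinearMap.comp_apply, ← ha, inner_self_eq_norm_sq_to_K]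
    push_cast
    rfl
  have h5 : ⟪φ, R φ⟫_ℂ = ((∫ p, ‖Q (ξ p)‖ ^ 2 ∂ν : ℝ) : ℂ) := by
    rw [h2.unique h1, funext h4, integral_complex_ofReal]
  have h6 : 0 ≤ ∫ p, ‖Q (ξ p)‖ ^ 2 ∂ν := integral_nonneg fun _ => by positivity
  have h7 : ∀ p, ‖Q (ξ p)‖ ^ 2 = (‖Q (ξ p)‖ₑ ^ 2).toReal := fun p => by simp
  have hmQ' : Measurable fun p => ‖Q (ξ p)‖ ^ 2 := by
    rw [funext h7]
    exact hmQ.ennreal_toReal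
  have hintQ : Integrable (fun p => ‖Q (ξ p)‖ ^ 2) ν := by
    refine (hint.const_mul (‖Q‖ ^ 2)).mono' hmQ'.aestronglyMeasurable
      (Filter.Eventually.of_forall fun p => ?_)
    rw [Real.norm_of_nonneg (by positivity), ← mul_pow]
    exact pow_le_pow_left₀ (norm_nonneg _) (Q.le_opNorm _) 2
  rw [h5]
  refine ⟨Complex.zero_le_real.2 h6, ?_⟩
  rw [← ofReal_norm, Complex.norm_real, Real.norm_of_nonneg h6,
    ofReal_integral_eq_lintegral_ofReal hintQ (Filter.Eventually.of_forall fun _ => by positivity)]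
  refine lintegral_congr fun p => ?_
  rw [ENNReal.ofReal_pow (norm_nonneg _), ofReal_norm, ← tsum_enorm_sq_inner_numberState]
  refine tsum_congr fun j => ?_
  have ha := ContinuousLinearMap.adjoint_inner_left Q (ξ p) (numberState j)
  rw [hQa] at ha
  rw [← ha, hξl, ← U.inner_map_map, U.apply_symm_apply]

/-- The left side is `‖S K†φ‖²`, expanded by Parseval. -/
theorem enorm_inner_conj_eq_tsum {ρ S : Fock ι →L[ℂ] Fock ι} (hSS : S ∘L S = ρ)
    (hSa : ContinuousLinearMap.adjoint S = S) (K : Fock ι →L[ℂ] Fock ι') (φ : Fock ι') :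
    ‖⟪φ, (K ∘L ρ ∘L ContinuousLinearMap.adjoint K) φ⟫_ℂ‖ₑ =
      ∑' i, ‖⟪φ, K (S (numberState i))⟫_ℂ‖ₑ ^ 2 := by
  have ha := ContinuousLinearMap.adjoint_inner_left S
    (S (ContinuousLinearMap.adjoint K φ)) (ContinuousLinearMap.adjoint K φ)
  rw [hSa, ContinuousLinearMap.adjoint_inner_left] at ha
  have h1 : ⟪φ, (K ∘L ρ ∘L ContinuousLinearMap.adjoint K) φ⟫_ℂ
      = ⟪S (ContinuousLinearMap.adjoint K φ), S (ContinuousLinearMap.adjoint K φ)⟫_ℂ := by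
    rw [ha, ← hSS]
    rfl
  have h2 : ‖⟪φ, (K ∘L ρ ∘L ContinuousLinearMap.adjoint K) φ⟫_ℂ‖ₑ
      = ‖S (ContinuousLinearMap.adjoint K φ)‖ₑ ^ 2 := by
    rw [h1, ← ofReal_norm, inner_self_eq_norm_sq_to_K, norm_pow, RCLike.norm_ofReal, abs_norm,
      ENNReal.ofReal_pow (norm_nonneg _), ofReal_norm]
  rw [h2, ← tsum_enorm_sq_inner_numberState]
  refine tsum_congr fun i => ?_
  have hb := ContinuousLinearMap.adjoint_inner_left S (ContinuousLinearMap.adjoint K φ)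
    (numberState i)
  rw [hSa] at hb
  rw [← hb, ContinuousLinearMap.adjoint_inner_right, ← inner_conj_symm, RCLike.enorm_conj]

end Round

/-- A POVM element of a one-round instrument has a Kraus family `(1 ⊗ ⟨j|√E) U (1 ⊗ |β⟩)`. -/
theorem isKrausFamily_of_isPartialTrace {n n' a a' : ℕ} {A : Op n n'}
    {σ : Fock (Fin a) →L[ℂ] Fock (Fin a)} {P : Measure (Fin a → ℂ)} [IsProbabilityMeasure P]
    (hP : ∀ φ φ' : Fock (Fin a), ⟪φ, σ φ'⟫_ℂ = ∫ β, ⟪φ, proj (coherent β) φ'⟫_ℂ ∂P)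
    (U : Fock (Fin n ⊕ Fin a) ≃ₗᵢ[ℂ] Fock (Fin n' ⊕ Fin a'))
    {E Q : Fock (Fin a') →L[ℂ] Fock (Fin a')} (hQQ : Q ∘L Q = E)
    (hQa : ContinuousLinearMap.adjoint Q = Q)
    (hA : ∀ ρ : TraceClass (Fin n), IsPartialTrace (onRight E ∘L
      (U : Fock (Fin n ⊕ Fin a) →L[ℂ] Fock (Fin n' ⊕ Fin a')) ∘L tensorOp ρ.1 σ ∘L
      (U.symm : Fock (Fin n' ⊕ Fin a') →L[ℂ] Fock (Fin n ⊕ Fin a))) (A ρ).1) :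
    IsKrausFamily A (Measure.count.prod P)
      fun p : (Fin a' → ℕ) × (Fin a → ℂ) => sandwich U (Q (numberState p.1)) (coherent p.2) := by
  have hm := measurable_inner_sandwich (ι := Fin n) (ι' := Fin n') U Q
  refine IsKrausFamily.of_lintegral (fun ψ φ => hm φ ψ) fun ρ hρ hs φ => ?_
  obtain ⟨S, hSa, hSS⟩ := exists_sqrt_of_isPositive hρ
  have hS : Summable fun k => ‖S (numberState k)‖ ^ 2 := by
    have h1 : ∀ k, ⟪numberState k, ρ.1 (numberState k)⟫_ℂ
        = ((‖S (numberState k)‖ ^ 2 : ℝ) : ℂ) := fun k => by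
      have ha := ContinuousLinearMap.adjoint_inner_left S (S (numberState k)) (numberState k)
      rw [hSa] at ha
      rw [← hSS, ContinuousLinearMap.comp_apply, ← ha, inner_self_eq_norm_sq_to_K]
      push_cast
      rfl
    rw [funext h1] at hs
    exact Complex.summable_ofReal.1 hs
  obtain ⟨h0, h1⟩ := IsPartialTrace.inner_eq_integral hSS hSa hS hP U hQQ hQa (hA ρ) φ
  refine ⟨h0, ?_⟩
  have hc : ∀ (i : Fin n → ℕ) (j : Fin a' → ℕ), Measurable fun β : Fin a → ℂ =>
      ‖⟪tensorVec φ (Q (numberState j)), U (jointVec S (i, β))⟫_ℂ‖ₑ ^ 2 := fun i j => by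
    have h := (hm φ (S (numberState i))).comp (measurable_prodMk_left (x := j))
    simp only [Function.comp_def, inner_sandwich] at h
    exact h.enorm.pow_const 2
  have hl : Measurable fun p : (Fin a' → ℕ) × (Fin a → ℂ) => ∑' i : Fin n → ℕ,
      ‖⟪tensorVec φ (Q (numberState p.1)), U (jointVec S (i, p.2))⟫_ℂ‖ₑ ^ 2 :=
    Measurable.tsum fun i => measurable_from_prod_countable_right fun j => hc i j
  have hr : Measurable fun p : (Fin n → ℕ) × (Fin a → ℂ) => ∑' j : Fin a' → ℕ,
      ‖⟪tensorVec φ (Q (numberState j)), U (jointVec S p)⟫_ℂ‖ₑ ^ 2 :=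
    Measurable.tsum fun j => measurable_from_prod_countable_right fun i => hc i j
  have h2 : ∀ p : (Fin a' → ℕ) × (Fin a → ℂ),
      ‖⟪φ, (sandwich U (Q (numberState p.1)) (coherent p.2) ∘L ρ.1 ∘L ContinuousLinearMap.adjoint
        (sandwich U (Q (numberState p.1)) (coherent p.2))) φ⟫_ℂ‖ₑ = ∑' i : Fin n → ℕ,
      ‖⟪tensorVec φ (Q (numberState p.1)), U (jointVec S (i, p.2))⟫_ℂ‖ₑ ^ 2 := fun p => by
    rw [enorm_inner_conj_eq_tsum hSS hSa]
    refine tsum_congr fun i => ?_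
    rw [inner_sandwich]
    rfl
  rw [lintegral_congr h2, h1, lintegral_prod _ hl.aemeasurable, lintegral_prod _ hr.aemeasurable,
    lintegral_count, lintegral_count]
  -- Both sides are now the same nonnegative quantity summed over `i`, `j` and integrated over `β`,
  -- in different orders.
  rw [tsum_congr fun j => lintegral_tsum fun i => (hc i j).aemeasurable,
    tsum_congr fun i => lintegral_tsum fun j => (hc i j).aemeasurable]
  exact ENNReal.tsum_comm

/-! ### Operators that map coherent states to coherent states -/

/-- `K` maps coherent states to multiples of coherent states, by a contraction and a displacement
of the amplitudes. -/
def IsCoherentMap {n n' : ℕ} (K : Fock (Fin n) →L[ℂ] Fock (Fin n')) : Prop :=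
  ∃ (c : (Fin n → ℂ) → ℂ) (M : Matrix (Fin n') (Fin n) ℂ) (δ : Fin n' → ℂ),
    (∀ x, ∑ i, ‖M.mulVec x i‖ ^ 2 ≤ ∑ i, ‖x i‖ ^ 2) ∧
    ∀ α, K (coherent α) = c α • coherent (M.mulVec α + δ)

theorem IsCoherentMap.comp {n n' n'' : ℕ} {K : Fock (Fin n) →L[ℂ] Fock (Fin n')}
    {L : Fock (Fin n') →L[ℂ] Fock (Fin n'')} (hL : IsCoherentMap L) (hK : IsCoherentMap K) :
    IsCoherentMap (L ∘L K) := by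
  obtain ⟨c, M, δ, hM, hc⟩ := hK
  obtain ⟨c', M', δ', hM', hc'⟩ := hL
  refine ⟨fun α => c α * c' (M.mulVec α + δ), M' * M, M'.mulVec δ + δ', fun x => ?_, fun α => ?_⟩
  · rw [← Matrix.mulVec_mulVec]
    exact (hM' _).trans (hM x)
  · rw [ContinuousLinearMap.comp_apply, hc, map_smul, hc', smul_smul, Matrix.mulVec_add,
      Matrix.mulVec_mulVec, add_assoc]

/-- `U` sends `|α⟩|β⟩` to a multiple of a product of coherent states; the discarded factor
contributes only its overlap with `χ`. The ancilla amplitude enters the retained factor as the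
displacement `V₁₂β`. -/
theorem IsPassiveLinear.isCoherentMap_sandwich {n n' a a' : ℕ}
    {U : Fock (Fin n ⊕ Fin a) ≃ₗᵢ[ℂ] Fock (Fin n' ⊕ Fin a')} (hU : IsPassiveLinear U)
    (χ : Fock (Fin a')) (β : Fin a → ℂ) : IsCoherentMap (sandwich U χ (coherent β)) := by
  obtain ⟨V, c, hc, hV⟩ := hU.exists_map_coherent
  have hl : ∀ (α : Fin n → ℂ) (β : Fin a → ℂ), (fun i => V.mulVec (Sum.elim α β) (Sum.inl i))
      = V.toBlocks₁₁.mulVec α + V.toBlocks₁₂.mulVec β := fun α β => by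
    funext i
    simp [Matrix.mulVec, dotProduct, Matrix.toBlocks₁₁, Matrix.toBlocks₁₂]
  refine ⟨fun α => c (Sum.elim α β) * ⟪χ, coherent fun j => V.mulVec (Sum.elim α β) (Sum.inr j)⟫_ℂ,
    V.toBlocks₁₁, V.toBlocks₁₂.mulVec β, fun x => ?_, fun α => ?_⟩
  -- With ancilla amplitude zero, the isometry property bounds the retained part of the output.
  · have h1 := hV (Sum.elim x 0)
    have h2 := hl x 0
    rw [Matrix.mulVec_zero, add_zero] at h2
    rw [Fintype.sum_sum_type, Fintype.sum_sum_type] at h1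
    simp only [Sum.elim_inl, Sum.elim_inr, Pi.zero_apply, norm_zero, ne_eq, OfNat.ofNat_ne_zero,
      not_false_eq_true, zero_pow, Finset.sum_const_zero, add_zero] at h1
    rw [← h2, ← h1]
    exact le_add_of_nonneg_right (Finset.sum_nonneg fun _ _ => by positivity)
  · have h1 : sandwich U χ (coherent β) (coherent α) =
        ContinuousLinearMap.adjoint (tensorRight (Fin n') χ)
          (U (tensorVec (coherent α) (coherent β))) := rfl
    have h2 : V.mulVec (Sum.elim α β) = Sum.elim (fun i => V.mulVec (Sum.elim α β) (Sum.inl i))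
        (fun j => V.mulVec (Sum.elim α β) (Sum.inr j)) := (Sum.elim_comp_inl_inr _).symm
    rw [h1, ← coherent_sumElim, hc, map_smul, h2, coherent_sumElim,
      adjoint_tensorRight_tensorVec, smul_smul, hl]

/-! ### Kraus families of free protocols -/

/-- `A` has a Kraus family that maps coherent states to coherent states. -/
def HasCoherentKraus {n n' : ℕ} (A : Op n n') : Prop :=
  ∃ (Ω : Type) (_ : MeasurableSpace Ω) (μ : Measure Ω) (_ : SigmaFinite μ)
    (K : Ω → Fock (Fin n) →L[ℂ] Fock (Fin n')),
    IsKrausFamily A μ K ∧ ∀ ω, IsCoherentMap (K ω)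

theorem IsOneRound.hasCoherentKraus {n n' : ℕ} {J : Type} {A : J → Op n n'} (h : IsOneRound A)
    (m : J) : HasCoherentKraus (A m) := by
  obtain ⟨a, a', σ, U, E, ⟨P, hP, hσ⟩, hU, hE, hA⟩ := h
  obtain ⟨Q, hQa, hQQ⟩ := exists_sqrt_of_isPositive (hE.positive m)
  exact ⟨(Fin a' → ℕ) × (Fin a → ℂ), inferInstance, Measure.count.prod P, inferInstance,
    fun p => sandwich U (Q (numberState p.1)) (coherent p.2),
    isKrausFamily_of_isPartialTrace (A := A m) (E := E m) hσ U hQQ hQa fun ρ => hA m ρ,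
    fun p => hU.isCoherentMap_sandwich (Q (numberState p.1)) p.2⟩

theorem HasCoherentKraus.comp {n n' n'' : ℕ} {A : Op n n'} {B : Op n' n''}
    (hB : HasCoherentKraus B) (hA : HasCoherentKraus A) : HasCoherentKraus (B.comp A) := by
  obtain ⟨Ω, _, μ, _, K, hK, hKc⟩ := hA
  obtain ⟨Ω', _, ν, _, L, hL, hLc⟩ := hB
  exact ⟨Ω' × Ω, inferInstance, ν.prod μ, inferInstance, _, hK.comp hL,
    fun p => (hLc p.1).comp (hKc p.2)⟩

theorem HasCoherentKraus.sum {n n' : ℕ} {X : Type} [Countable X] {A : X → Op n n'}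
    {A' : Op n n'} (hA : ∀ x, HasCoherentKraus (A x))
    (h : ∀ (ρ : TraceClass (Fin n)) (φ φ' : Fock (Fin n')),
      HasSum (fun x => ⟪φ, (A x ρ).1 φ'⟫_ℂ) ⟪φ, (A' ρ).1 φ'⟫_ℂ) : HasCoherentKraus A' := by
  choose Ω hΩ μ hμ K hK hKc using hA
  exact ⟨Σ x, Ω x, inferInstance, sigmaMeasure μ, inferInstance, _, IsKrausFamily.sum hK h,
    fun s => hKc s.1 s.2⟩

/-- Countability of the outcomes is carried through the induction because the next coarse-graining
sums over them, and σ-finiteness of the disjoint union needs a countable index. -/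
theorem InP.countable_and_hasCoherentKraus {r n n' : ℕ} {J : Type} {A : J → Op n n'}
    (h : InP r A) : Countable J ∧ ∀ m, HasCoherentKraus (A m) := by
  induction h with
  | one h => exact ⟨inferInstance, h.hasCoherentKraus⟩
  | @link r n n' n'' J J' _ L _ A B A' hA hB h ih =>
    obtain ⟨hJ, ih⟩ := ih
    obtain ⟨part, hpart⟩ := h
    refine ⟨inferInstance, fun l => ?_⟩
    have hBA : ∀ x : {x : Σ m, L m // part x = l},
        HasCoherentKraus ((B x.1.1 x.1.2).comp (A x.1.1)) := fun x =>
      HasCoherentKraus.comp (IsOneRound.hasCoherentKraus (hB x.1.1) x.1.2) (ih x.1.1)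
    exact HasCoherentKraus.sum hBA (hpart l)

/-! ### No amplification -/

theorem coherent_apply_zero {ι : Type} [Fintype ι] (α : ι → ℂ) : coherent α 0 ≠ 0 := by
  simp [coherent_apply, coherentCoeff]

/-- The ratio of one-photon to vacuum coordinate recovers the amplitude of any nonzero multiple of a
coherent state. -/
theorem coherent_apply_single {ι : Type} [Fintype ι] [DecidableEq ι] (α : ι → ℂ) (i : ι) :
    coherent α (Pi.single i 1) = α i * coherent α 0 := by
  have h := congrFun (annihilate_coherent i α) 0
  simpa [annihilate] using h

/-- If `K` maps coherent states to coherent states and amplifies by `g` on a dense subset of a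
non-empty open set, wherever it does not vanish, then it vanishes on this set. -/
theorem IsCoherentMap.eq_zero_of_amplifies {n : ℕ} {K : Fock (Fin n) →L[ℂ] Fock (Fin n)}
    (hK : IsCoherentMap K) (hn : 1 ≤ n) {g : ℂ} (hg : 1 < ‖g‖) {W : Set (Fin n → ℂ)}
    (hW : IsOpen W) {D : Set (Fin n → ℂ)} (hD : Dense D)
    (h : ∀ α ∈ D ∩ W, ∀ i, K (coherent α) (Pi.single i 1) = g * α i * K (coherent α) 0) :
    ∀ α ∈ W, K (coherent α) = 0 := by
  obtain ⟨c, M, δ, hM, hc⟩ := hK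
  by_contra! hcon
  obtain ⟨α₀, hα₀, hne⟩ := hcon
  have hcont : Continuous fun α : Fin n → ℂ => K (coherent α) :=
    K.continuous.comp continuous_coherent
  set O := W ∩ {α | K (coherent α) ≠ 0}
  have hO : IsOpen O := hW.inter (isOpen_ne_fun hcont continuous_const)
  have hDO : ∀ α ∈ D ∩ O, M.mulVec α + δ = g • α := by
    rintro α ⟨hαD, hαW, hα⟩
    have hc0 : c α ≠ 0 := fun h0 => hα (by rw [hc, h0, zero_smul])
    funext i
    have h1 := h α ⟨hαD, hαW⟩ i
    rw [hc] at h1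
    change c α * coherent (M.mulVec α + δ) (Pi.single i 1)
      = g * α i * (c α * coherent (M.mulVec α + δ) 0) at h1
    rw [coherent_apply_single] at h1
    have h2 : (c α * coherent (M.mulVec α + δ) 0) * (M.mulVec α + δ) i =
        (c α * coherent (M.mulVec α + δ) 0) * (g • α) i := by
      rw [Pi.smul_apply, smul_eq_mul]
      linear_combination h1
    exact mul_left_cancel₀ (mul_ne_zero hc0 (coherent_apply_zero _)) h2
  -- The equation is a closed condition, and `D` is dense in the open set `O`.
  have hMO : ∀ α ∈ O, M.mulVec α + δ = g • α := by
    have hcl : IsClosed {α : Fin n → ℂ | M.mulVec α + δ = g • α} := by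
      refine isClosed_eq ?_ (continuous_const_smul g)
      exact (Continuous.matrix_mulVec continuous_const continuous_id).add continuous_const
    intro α hα
    have h1 : α ∈ closure (O ∩ D) := hD.open_subset_closure_inter hO hα
    exact closure_minimal (fun x hx => hDO x ⟨hx.2, hx.1⟩) hcl h1
  have hα₀O : α₀ ∈ O := ⟨hα₀, hne⟩
  obtain ⟨ε, hε, hball⟩ := Metric.isOpen_iff.1 hO α₀ hα₀O
  -- Any small nonzero vector would do: subtracting the equations at `α₀ + v` and `α₀` removes `δ`.
  -- In the sup norm this one has length below `ε`.
  set v : Fin n → ℂ := fun _ => ((ε / 2 : ℝ) : ℂ)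
  have hv : α₀ + v ∈ O := by
    refine hball ?_
    rw [Metric.mem_ball, dist_eq_norm, add_sub_cancel_left]
    refine (pi_norm_lt_iff hε).2 fun i => ?_
    rw [Complex.norm_real, Real.norm_of_nonneg (by positivity)]
    exact half_lt_self hε
  have hMv : M.mulVec v = g • v := by
    have h1 := hMO _ hv
    have h2 := hMO _ hα₀O
    rw [Matrix.mulVec_add, smul_add, ← h2] at h1
    have h3 : M.mulVec v + (M.mulVec α₀ + δ) = g • v + (M.mulVec α₀ + δ) := by
      rw [← add_comm (M.mulVec α₀ + δ) (g • v), ← h1]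
      abel
    exact add_right_cancel h3
  have h4 := hM v
  rw [hMv] at h4
  simp only [Pi.smul_apply, smul_eq_mul, norm_mul, mul_pow, ← Finset.mul_sum] at h4
  have h5 : 0 < ∑ i, ‖v i‖ ^ 2 := by
    refine Finset.sum_pos (fun i _ => ?_) ⟨⟨0, hn⟩, Finset.mem_univ _⟩
    have : v i ≠ 0 := Complex.ofReal_ne_zero.2 (by positivity)
    positivity
  nlinarith [mul_pos (sub_pos.2 hg) h5]

theorem HasCoherentKraus.not_amplifies {n : ℕ} {A : Op n n} (hA : HasCoherentKraus A)
    (hn : 1 ≤ n) {g : ℂ} (hg : 1 < ‖g‖) {W : Set (Fin n → ℂ)} (hW : IsOpen W)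
    (hWn : W.Nonempty) : ¬ ∀ α ∈ W, ∃ p : ℝ, 0 < p ∧
      A (pure (coherent α)) = (p : ℂ) • pure (coherent (g • α)) := by
  intro hamp
  obtain ⟨Ω, _, μ, _, K, hK, hKc⟩ := hA
  have hproj : ∀ ω α φ, ⟪φ, (K ω ∘L (pure (coherent α)).1 ∘L
      ContinuousLinearMap.adjoint (K ω)) φ⟫_ℂ = ⟪φ, K ω (coherent α)⟫_ℂ *
        ⟪K ω (coherent α), φ⟫_ℂ := fun ω α φ => by
    change ⟪φ, K ω (proj (coherent α) (ContinuousLinearMap.adjoint (K ω) φ))⟫_ℂ = _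
    rw [proj, InnerProductSpace.rankOne_apply, map_smul, inner_smul_right,
      ContinuousLinearMap.adjoint_inner_right, mul_comm]
  -- For `φ` orthogonal to the output state, `∫ |⟨φ, K|α⟩⟩|² dμ = 0`, so the integrand vanishes
  -- almost everywhere.
  have hout : ∀ α ∈ W, ∀ φ, ⟪φ, coherent (g • α)⟫_ℂ = 0 →
      ∀ᵐ ω ∂μ, ⟪φ, K ω (coherent α)⟫_ℂ = 0 := fun α hα φ hφ => by
    obtain ⟨p, -, hp⟩ := hamp α hα
    have h1 := hK.lintegral_eq (ρ := pure (coherent α))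
      (InnerProductSpace.isPositive_rankOne_self _) φ
    have h2 : ⟪φ, (A (pure (coherent α))).1 φ⟫_ℂ = 0 := by
      rw [hp]
      change ⟪φ, (p : ℂ) • proj (coherent (g • α)) φ⟫_ℂ = 0
      rw [proj, InnerProductSpace.rankOne_apply, inner_smul_right, inner_smul_right, hφ, mul_zero,
        mul_zero]
    rw [h2, enorm_zero, lintegral_eq_zero_iff (measurable_inner_kraus hK.measurable _ φ φ).enorm]
      at h1
    filter_upwards [h1] with ω hω
    have h3 : ⟪φ, K ω (coherent α)⟫_ℂ * ⟪K ω (coherent α), φ⟫_ℂ = 0 := by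
      rw [← hproj]
      exact enorm_eq_zero.1 hω
    rw [mul_eq_zero, inner_eq_zero_symm (x := K ω (coherent α)), or_self] at h3
    exact h3
  have hloc : ∀ α ∈ W, ∀ i, ∀ᵐ ω ∂μ,
      K ω (coherent α) (Pi.single i 1) = g * α i * K ω (coherent α) 0 := fun α hα i => by
    have h1 : ∀ x : Fock (Fin n), ⟪numberState (Pi.single i 1) -
        (starRingEnd ℂ) (g * α i) • numberState 0, x⟫_ℂ
        = x (Pi.single i 1) - g * α i * x 0 := fun x => by
      rw [inner_sub_left, inner_smul_left, inner_numberState, inner_numberState,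
        Complex.conj_conj]
    -- This test vector is orthogonal to `|gα⟩` because the one-photon coordinate of `|gα⟩` is `gαᵢ`
    -- times its vacuum coordinate.
    have h2 := hout α hα (numberState (Pi.single i 1) -
      (starRingEnd ℂ) (g * α i) • numberState 0) (by
        rw [h1, coherent_apply_single]
        simp)
    filter_upwards [h2] with ω hω
    rw [h1] at hω
    exact sub_eq_zero.1 hω
  -- The exceptional null set depends on `α`; restricting to countably many `α` leaves a single null
  -- set.
  obtain ⟨D, hDc, hDd⟩ := TopologicalSpace.exists_countable_dense (Fin n → ℂ)
  have hall : ∀ᵐ ω ∂μ, ∀ α ∈ W, K ω (coherent α) = 0 := by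
    have h1 : ∀ᵐ ω ∂μ, ∀ α ∈ D ∩ W, ∀ i,
        K ω (coherent α) (Pi.single i 1) = g * α i * K ω (coherent α) 0 := by
      refine (ae_ball_iff (hDc.mono Set.inter_subset_left)).2 fun α hα => ?_
      exact ae_all_iff.2 (hloc α hα.2)
    filter_upwards [h1] with ω hω
    exact (hKc ω).eq_zero_of_amplifies hn hg hW hDd hω
  obtain ⟨α, hα⟩ := hWn
  obtain ⟨p, hp0, hp⟩ := hamp α hα
  have h1 := hK.apply_eq (pure (coherent α)) (coherent (g • α)) (coherent (g • α))
  rw [integral_congr_ae (g := fun _ => 0) (by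
    filter_upwards [hall] with ω hω
    rw [hproj, hω α hα, inner_zero_left, mul_zero]), integral_zero, hp] at h1
  change ⟪coherent (g • α), (p : ℂ) • proj (coherent (g • α)) (coherent (g • α))⟫_ℂ = 0 at h1
  rw [proj, InnerProductSpace.rankOne_apply, inner_smul_right, inner_smul_right,
    inner_self_eq_norm_sq_to_K, norm_coherent] at h1
  simp [hp0.ne'] at h1

end LinearOptics

end

theorem theorem1 :
    (∀ (n n' : ℕ) (J : Type) (A : J → LinearOptics.Op n n'), LinearOptics.IsFree A → ∀ m : J,
      ∃ (Ω : Type) (_ : MeasurableSpace Ω) (μ : Measure Ω) (_ : SigmaFinite μ)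
        (K : Ω → LinearOptics.Fock (Fin n) →L[ℂ] LinearOptics.Fock (Fin n'))
        (c : Ω → (Fin n → ℂ) → ℂ) (M : Ω → Matrix (Fin n') (Fin n) ℂ) (δ : Ω → Fin n' → ℂ),
        LinearOptics.IsKrausFamily (A m) μ K ∧
        (∀ ω, LinearOptics.IsContraction (M ω)) ∧
        ∀ (ω : Ω) (α : Fin n → ℂ),
          K ω (LinearOptics.coherent α)
            = c ω α • LinearOptics.coherent ((M ω).mulVec α + δ ω)) ∧
    (∀ (n : ℕ) (J : Type) (A : J → LinearOptics.Op n n), 1 ≤ n → LinearOptics.IsFree A →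
      ∀ (m : J) (g : ℂ), 1 < ‖g‖ → ∀ W : Set (Fin n → ℂ), IsOpen W → W.Nonempty →
        ¬ ∀ α ∈ W, ∃ p : ℝ, 0 < p ∧
          A m (LinearOptics.pure (LinearOptics.coherent α))
            = (p : ℂ) • LinearOptics.pure (LinearOptics.coherent (g • α))) := by
  refine ⟨fun n n' J A ⟨r, hA⟩ m => ?_, fun n J A hn ⟨r, hA⟩ m g hg W hW hWn =>
    (hA.countable_and_hasCoherentKraus.2 m).not_amplifies hn hg hW hWn⟩
  obtain ⟨Ω, hΩ, μ, hμ, K, hK, hKc⟩ := hA.countable_and_hasCoherentKraus.2 m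
  choose c M δ hM hc using hKc
  exact ⟨Ω, hΩ, μ, hμ, K, c, M, δ, hK, fun ω => LinearOptics.isContraction_of_sum_sq_le (hM ω), hc⟩
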